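/- **Bi-FEAST Rayleigh–Ritz convergence.** Let $A,B\in\mathbb C^{n\times n}$ with $B$ invertible and $B^{-1}A$ diagonalizable: $AX=BX\Lambda$, $\Lambda=\operatorname{diag}(\lambda_1,\dots,\lambda_n)$, $Y^HBX=I$, with $x_j,y_j$ the columns of $X,Y$. Let $\rho(\mu)=\sum_{l=1}^q\alpha_l/(\beta_l-\mu)$ be a rational function none of whose $\beta_l$ is an eigenvalue $\lambda_j$, put $\rho(B^{-1}A)=\sum_l\alpha_l(\beta_lI-B^{-1}A)^{-1}$ and $\gamma_j=\rho(\lambda_j)$, and number the eigenvalues so that $|\gamma_1|\ge\dots\ge|\gamma_n|$. Let $1\le m'\le p<n$ with $|\gamma_{m'+1}|<|\gamma_{m'}|$ and $|\gamma_{p+1}|<|\gamma_p|$, and put $\varepsilon=|\gamma_{p+1}/\gamma_{m'}|$ and $\Lambda_{m'}=\operatorname{diag}(\lambda_1,\dots,\lambda_{m'})$. Let $U_{(0)},V_{(0)}\in\mathbb C^{n\times p}$ satisfy $V_{(0)}^HBU_{(0)}=I_p$, with $[y_1,\dots,y_p]^HBU_{(0)}$ and $V_{(0)}^HB[x_1,\dots,x_p]$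 nonsingular. Consider the Bi-FEAST iteration in exact arithmetic: for $k=1,2,\dots$ set $\widehat U=\rho(B^{-1}A)U_{(k-1)}$, $\widehat V=B^{-H}\rho(B^{-1}A)^HB^HV_{(k-1)}$, $\widehat A=\widehat V^HA\widehat U$, $\widehat B=\widehat V^HB\widehat U$; solve the reduced eigenproblem $\widehat A=\widehat BW\widehat\Lambda_{(k)}Z^H\widehat B$, $Z^H\widehat BW=I_p$, with $\widehat\Lambda_{(k)}$ diagonal (assumed solvable in every step, for an arbitrary choice of the solution); set $U_{(k)}=\widehat UW$, $V_{(k)}=\widehat VZ$. Then there is a constant $C$, independent of $k$ and of the choices of $W,Z,\widehat\Lambda_{(k)}$, such that for every $k\ge1$ (with $\|\cdot\|$ the Euclidean and the induced operator norm): 1. $\widehat B^{-1}\widehat A$ is similar to, and so has the same eigenvalues as, a block matrix $\begin{bmatrix}A'_{11}&A'_{12}\\A'_{21}&A'_{22}\end{bmatrix}$ with $A'_{11}\in\mathbb C^{m'\times m'}$, $\|A'_{11}-\Lambda_{m'}\|\le C\varepsilon^{2k}$, $\|A'_{21}\|\le C\varepsilon^k$ and $\|A'_{12}\|\le C\varepsilon^k$.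 2. There are $m'$ distinct positions on the diagonal of $\widehat\Lambda_{(k)}$, with entries $\hat\lambda_1,\dots,\hat\lambda_{m'}$ and corresponding columns $u_j$ of $U_{(k)}$ and $v_j$ of $V_{(k)}$, such that for $j=1,\dots,m'$ $$|\hat\lambda_j-\lambda_j|\le C\varepsilon^{2k},\qquad \|(A-\hat\lambda_jB)u_j\|\le C\varepsilon^k\|u_j\|,\qquad \|(A-\hat\lambda_jB)^Hv_j\|\le C\varepsilon^k\|v_j\|.$$ -/

import Mathlib

open Matrix
open scoped Matrix.Norms.L2Operator

noncomputable section

namespace BiFEAST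

/-- The rational function `ρ(μ) = ∑ₗ αₗ / (βₗ - μ)` in partial fraction form. -/
def rho {q : ℕ} (α β : Fin q → ℂ) (μ : ℂ) : ℂ :=
  ∑ l, α l / (β l - μ)

/-- The same rational function applied to a matrix: `ρ(M) = ∑ₗ αₗ (βₗ I - M)⁻¹`. -/
def rhoMat {n q : ℕ} (α β : Fin q → ℂ) (M : Matrix (Fin n) (Fin n) ℂ) :
    Matrix (Fin n) (Fin n) ℂ :=
  ∑ l, α l • (β l • (1 : Matrix (Fin n) (Fin n) ℂ) - M)⁻¹

/-- The approximate right spectral projector `ρ(B⁻¹A)`. -/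
def rightProj {n q : ℕ} (α β : Fin q → ℂ) (A B : Matrix (Fin n) (Fin n) ℂ) :
    Matrix (Fin n) (Fin n) ℂ :=
  rhoMat α β (B⁻¹ * A)

/-- The approximate left spectral projector `B⁻ᴴ ρ(B⁻¹A)ᴴ Bᴴ`. -/
def leftProj {n q : ℕ} (α β : Fin q → ℂ) (A B : Matrix (Fin n) (Fin n) ℂ) :
    Matrix (Fin n) (Fin n) ℂ :=
  (Bᴴ)⁻¹ * (rhoMat α β (B⁻¹ * A))ᴴ * Bᴴ

/-- The first `p` columns of an `n × n` matrix. -/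
def firstCols {n p : ℕ} (hp : p ≤ n) (X : Matrix (Fin n) (Fin n) ℂ) :
    Matrix (Fin n) (Fin p) ℂ :=
  X.submatrix id (Fin.castLE hp)

/-- The Euclidean norm of a complex vector. -/
def enorm2 {n : ℕ} (v : Fin n → ℂ) : ℝ := ‖WithLp.toLp 2 v‖

/-- The reduced matrix `V̂ᴴ S Û` (with `S = A` or `S = B`) formed from the iterates `U`, `V`,
where `Û = ρ(B⁻¹A) U` and `V̂ = B⁻ᴴ ρ(B⁻¹A)ᴴ Bᴴ V`. -/
def reduced {n p q : ℕ} (α β : Fin q → ℂ) (A B S : Matrix (Fin n) (Fin n) ℂ)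
    (U V : Matrix (Fin n) (Fin p) ℂ) : Matrix (Fin p) (Fin p) ℂ :=
  (leftProj α β A B * V)ᴴ * S * (rightProj α β A B * U)

/-- An (infinite) run of the iteration Bi-FEAST in exact arithmetic, started at `U₀`, `V₀`.
`U k`, `V k` are the iterates after `k` steps; `W k`, `Z k`, `ritz k` are the outcome of the
reduced eigenproblem solved in step `k ≥ 1` (the values at `k = 0` are irrelevant).
The reduced problem `Â = B̂ W Λ̂ Zᴴ B̂` is solved by an eigendecomposition, that is, with
bi-orthogonal left and right eigenvectors, `Zᴴ B̂ W = I`. -/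
structure IsRun {n p q : ℕ} (α β : Fin q → ℂ) (A B : Matrix (Fin n) (Fin n) ℂ)
    (U₀ V₀ : Matrix (Fin n) (Fin p) ℂ)
    (U V : ℕ → Matrix (Fin n) (Fin p) ℂ) (W Z : ℕ → Matrix (Fin p) (Fin p) ℂ)
    (ritz : ℕ → Fin p → ℂ) : Prop where
  initU : U 0 = U₀
  initV : V 0 = V₀
  solve : ∀ k, reduced α β A B A (U k) (V k) =
    reduced α β A B B (U k) (V k) * W (k + 1) * diagonal (ritz (k + 1)) * (Z (k + 1))ᴴ
      * reduced α β A B B (U k) (V k)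
  biorth : ∀ k, (Z (k + 1))ᴴ * reduced α β A B B (U k) (V k) * W (k + 1) = 1
  stepU : ∀ k, U (k + 1) = rightProj α β A B * U k * W (k + 1)
  stepV : ∀ k, V (k + 1) = leftProj α β A B * V k * Z (k + 1)

end BiFEAST

end

open Filter Topology

namespace BiFEAST

/-! In eigenvector coordinates one step multiplies by `diag(γ)` on either side, up to a change of
basis of the trial spaces (`IsRun.exists_factorization`). Split the coordinates into the first `p`
and the remaining `n - p`. After factoring out the invertible leading `p × p` part, the right basis
becomes `[1; M]` and the left one `[1, L]`, where `L = Γ₁⁻ᵏ F Γ₂ᵏ` and `M = Γ₂ᵏ E Γ₁⁻ᵏ` with fixed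
`F`, `E`. Thus the reduced pencil is equivalent to `(Λ + L Λ₃ M, 1 + L M)`, where `Λ₃` holds the
unwanted eigenvalues.

The couplings are graded: with `δ = |γ_{p+1}/γ_p| < 1`, the parts of `L` and `M` belonging to the
first `m'` indices are `O(εᵏ)`, the others `O(δᵏ)` (`exists_gradedBound`). The identity
`pencilMatrix_sub_diagonal` writes the deviation of the reduced matrix from `Λ` with `L` as left
factor and `Λ₃ M - M Λ` as right factor; its blocks therefore inherit products of these rates, which
gives the first claim.

For the second claim, an eigenvector `g` with eigenvalue `z` satisfies `(Λ - z) g = L (z - Λ₃) M g`.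
If `z` is near a wanted eigenvalue, it stays away from the trailing part of `Λ`, because the gap of
`|γ|` at `m'` makes wanted and unwanted eigenvalues distinct. The trailing part of `g` can then be
absorbed, so that `M g` is `O(εᵏ)` relative to the leading part. Another factor `O(εᵏ)` comes from
`L` in the leading rows. Since `Λ` is diagonal, this yields the eigenvalue error `O(ε²ᵏ)` and
residual `O(εᵏ)` without any conditioning of the Ritz vectors (`IsPencilEigenvector.l2norm_bounds`).
The left vectors solve the transposed pencil, of the same form.

Ritz values are matched to the `λⱼ`, with multiplicity, by compactness
(`exists_perm_eigenvalues_near_diagonal`), once `δᵏ` is small. For the other `k`, `εᵏ` is bounded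
below and crude bounds suffice (`pow_lt_or_le_pow`). -/

/-- The Euclidean norm of a complex vector over an arbitrary finite index type. -/
noncomputable def l2norm {ι : Type*} [Fintype ι] (v : ι → ℂ) : ℝ := ‖WithLp.toLp 2 v‖

/-! ### Euclidean norms of vectors and the operator norm -/

section L2Norm

variable {ι κ : Type*} [Fintype ι] [Fintype κ]

lemma l2norm_nonneg (v : ι → ℂ) : 0 ≤ l2norm v := norm_nonneg _

lemma l2norm_sq (v : ι → ℂ) : l2norm v ^ 2 = ∑ i, ‖v i‖ ^ 2 := by
  simp [l2norm, EuclideanSpace.norm_sq_eq]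

lemma l2norm_add_le (v w : ι → ℂ) : l2norm (v + w) ≤ l2norm v + l2norm w :=
  norm_add_le (WithLp.toLp 2 v) (WithLp.toLp 2 w)

lemma l2norm_eq_zero {v : ι → ℂ} : l2norm v = 0 ↔ v = 0 := by
  simp [l2norm]

lemma l2norm_const_mul (c : ℂ) (v : ι → ℂ) : l2norm (fun i => c * v i) = ‖c‖ * l2norm v :=
  norm_smul c (WithLp.toLp 2 v)

lemma l2norm_mulVec_le [DecidableEq κ] (M : Matrix ι κ ℂ) (v : κ → ℂ) :
    l2norm (M *ᵥ v) ≤ ‖M‖ * l2norm v :=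
  M.l2_opNorm_mulVec (WithLp.toLp 2 v)

lemma l2norm_mono {v w : ι → ℂ} (h : ∀ i, ‖v i‖ ≤ ‖w i‖) : l2norm v ≤ l2norm w := by
  refine (sq_le_sq₀ (l2norm_nonneg v) (l2norm_nonneg w)).mp ?_
  rw [l2norm_sq, l2norm_sq]
  exact Finset.sum_le_sum fun i _ => by gcongr; exact h i

lemma l2norm_mul_le {d v : ι → ℂ} {R : ℝ} (hR : 0 ≤ R) (h : ∀ i, ‖d i‖ ≤ R) :
    l2norm (fun i => d i * v i) ≤ R * l2norm v := by
  have h1 : l2norm (fun i => (R : ℂ) * v i) = R * l2norm v := by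
    rw [l2norm_const_mul, Complex.norm_of_nonneg hR]
  rw [← h1]
  refine l2norm_mono fun i => ?_
  rw [norm_mul, norm_mul, Complex.norm_of_nonneg hR]
  gcongr
  exact h i

lemma le_l2norm_mul {d v : ι → ℂ} {r : ℝ} (hr : 0 ≤ r) (h : ∀ i, r ≤ ‖d i‖) :
    r * l2norm v ≤ l2norm (fun i => d i * v i) := by
  have h1 : l2norm (fun i => (r : ℂ) * v i) = r * l2norm v := by
    rw [l2norm_const_mul, Complex.norm_of_nonneg hr]
  rw [← h1]
  refine l2norm_mono fun i => ?_
  rw [norm_mul, norm_mul, Complex.norm_of_nonneg hr]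
  gcongr
  exact h i

lemma l2norm_star (v : ι → ℂ) : l2norm (star v) = l2norm v :=
  le_antisymm (l2norm_mono fun i => by simp) (l2norm_mono fun i => by simp)

lemma l2norm_comp_equiv (e : κ ≃ ι) (v : ι → ℂ) : l2norm (v ∘ e) = l2norm v := by
  rw [← sq_eq_sq₀ (l2norm_nonneg _) (l2norm_nonneg _), l2norm_sq, l2norm_sq]
  exact e.sum_comp fun i => ‖v i‖ ^ 2

lemma l2norm_sumElim_sq (v : ι → ℂ) (w : κ → ℂ) :
    l2norm (Sum.elim v w) ^ 2 = l2norm v ^ 2 + l2norm w ^ 2 := by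
  simp [l2norm_sq]

lemma l2norm_sumElim_le (v : ι → ℂ) (w : κ → ℂ) :
    l2norm (Sum.elim v w) ≤ l2norm v + l2norm w := by
  have := l2norm_nonneg v
  have := l2norm_nonneg w
  refine (sq_le_sq₀ (l2norm_nonneg _) (by positivity)).mp ?_
  rw [l2norm_sumElim_sq]
  nlinarith

lemma l2norm_le_sumElim_left (v : ι → ℂ) (w : κ → ℂ) : l2norm v ≤ l2norm (Sum.elim v w) := by
  refine (sq_le_sq₀ (l2norm_nonneg _) (l2norm_nonneg _)).mp ?_
  rw [l2norm_sumElim_sq]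
  nlinarith [sq_nonneg (l2norm w)]

lemma l2norm_comp_inl_le (v : ι ⊕ κ → ℂ) : l2norm (v ∘ Sum.inl) ≤ l2norm v := by
  conv_rhs => rw [← Sum.elim_comp_inl_inr v]
  exact l2norm_le_sumElim_left _ _

lemma norm_le_of_l2norm_mulVec_le [DecidableEq κ] {M : Matrix ι κ ℂ} {R : ℝ} (hR : 0 ≤ R)
    (h : ∀ v, l2norm (M *ᵥ v) ≤ R * l2norm v) : ‖M‖ ≤ R := by
  rw [l2_opNorm_def]
  exact ContinuousLinearMap.opNorm_le_bound _ hR fun x => h x.ofLp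

/-- Transpose and conjugate transpose differ by entrywise conjugation, which preserves Euclidean
norms. The plain transpose is what turns the left eigenvectors of the pencil into right ones. -/
lemma norm_transpose_le [DecidableEq ι] [DecidableEq κ] (M : Matrix ι κ ℂ) : ‖Mᵀ‖ ≤ ‖M‖ := by
  refine norm_le_of_l2norm_mulVec_le (norm_nonneg _) fun v => ?_
  have h : Mᵀ *ᵥ v = star (Mᴴ *ᵥ star v) := by
    rw [star_mulVec, star_star, conjTranspose_conjTranspose, mulVec_transpose]
  rw [h, l2norm_star, ← l2_opNorm_conjTranspose M, ← l2norm_star v]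
  exact l2norm_mulVec_le _ _

end L2Norm

/-! ### Matching of eigenvalues -/

/-- Equal polynomial functions have equal root multisets, so each value is taken equally often by
both families; bijections between the fibres glue to a permutation. -/
lemma exists_perm_of_prod_sub_eq {ι : Type*} [Fintype ι] {r s : ι → ℂ}
    (h : ∀ z, ∏ i, (z - r i) = ∏ i, (z - s i)) :
    ∃ σ : Equiv.Perm ι, ∀ i, r (σ i) = s i := by
  have h1 : (∏ i, (Polynomial.X - Polynomial.C (r i))) =
      ∏ i, (Polynomial.X - Polynomial.C (s i)) := by
    refine Polynomial.funext fun z => ?_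
    simpa [Polynomial.eval_prod] using h z
  have key : ∀ t : ι → ℂ, (∏ i, (Polynomial.X - Polynomial.C (t i))).roots =
      Finset.univ.val.map t := by
    intro t
    have := Polynomial.roots_multiset_prod_X_sub_C (Finset.univ.val.map t)
    rwa [Multiset.map_map] at this
  have h2 : Finset.univ.val.map r = Finset.univ.val.map s := by rw [← key, ← key, h1]
  have hcard : ∀ z, Nonempty ({i // s i = z} ≃ {i // r i = z}) := by
    classical
    intro z
    have h3 := congrArg (Multiset.count z) h2
    rw [Multiset.count_map, Multiset.count_map] at h3
    rw [← Fintype.card_eq, Fintype.card_subtype, Fintype.card_subtype]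
    simpa only [Finset.card_def, Finset.filter_val, eq_comm] using h3.symm
  exact ⟨Equiv.ofFiberEquiv fun z => (hcard z).some,
    fun i => Equiv.ofFiberEquiv_map (fun z => (hcard z).some) i⟩

section Eigenvalues

variable {ι : Type*} [Fintype ι] [DecidableEq ι]

lemma norm_eigenvalue_le {A : Matrix ι ι ℂ} {v : ι → ℂ} {z : ℂ} (hv : v ≠ 0)
    (h : A *ᵥ v = z • v) : ‖z‖ ≤ ‖A‖ := by
  have h1 : l2norm (z • v) = ‖z‖ * l2norm v := l2norm_const_mul z v
  have h2 := l2norm_mulVec_le A v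
  rw [h, h1] at h2
  have h3 : 0 < l2norm v :=
    lt_of_le_of_ne (l2norm_nonneg v) fun h => hv (l2norm_eq_zero.mp h.symm)
  exact le_of_mul_le_mul_right h2 h3

lemma col_ne_zero {G : Matrix ι ι ℂ} (hG : IsUnit G.det) (i : ι) : G.col i ≠ 0 := by
  intro h
  exact hG.ne_zero (det_eq_zero_of_column_eq_zero i fun j => congrFun h j)

lemma norm_diagonalization_le {A G : Matrix ι ι ℂ} {r : ι → ℂ} (hG : IsUnit G.det)
    (h : A * G = G * diagonal r) (i : ι) : ‖r i‖ ≤ ‖A‖ := by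
  refine norm_eigenvalue_le (col_ne_zero hG i) ?_
  ext j
  have := congrFun (congrFun h j) i
  rw [mul_diagonal] at this
  simpa [mul_apply, mulVec, dotProduct, mul_comm] using this

lemma det_scalar_sub_of_diagonalization {A G : Matrix ι ι ℂ} {r : ι → ℂ} (hG : IsUnit G.det)
    (h : A * G = G * diagonal r) (z : ℂ) :
    (diagonal (fun _ => z) - A).det = ∏ i, (z - r i) := by
  have h1 : (diagonal (fun _ => z) - A) * G = G * diagonal (fun i => z - r i) := by
    rw [sub_mul, h, ← diagonal_sub, mul_sub]
    congr 1
    ext i j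
    simp [mul_comm]
  have h2 := congrArg det h1
  rw [det_mul, det_mul, det_diagonal, mul_comm] at h2
  exact mul_left_cancel₀ hG.ne_zero h2

/-- The eigenvalues of a diagonalizable matrix close to `diagonal l` can be matched with the
entries of `l`. -/
lemma exists_perm_eigenvalues_near_diagonal (l : ι → ℂ) {η : ℝ} (hη : 0 < η) :
    ∃ τ > 0, ∀ (A G : Matrix ι ι ℂ) (r : ι → ℂ), ‖A - diagonal l‖ < τ → IsUnit G.det →
      A * G = G * diagonal r → ∃ σ : Equiv.Perm ι, ∀ i, ‖r (σ i) - l i‖ < η := by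
  -- Take a sequence of counterexamples with `A k → diagonal l`. Its eigenvalues are bounded by `‖A
  -- k‖`, hence converge along a subsequence.
  by_contra! hcon
  choose A G r hA hG hAG hr using fun k : ℕ =>
    hcon (1 / ((k : ℝ) + 1)) (by positivity)
  have hlim : Tendsto A atTop (𝓝 (diagonal l)) := by
    rw [tendsto_iff_norm_sub_tendsto_zero]
    exact squeeze_zero (fun _ => norm_nonneg _) (fun k => (hA k).le)
      tendsto_one_div_add_atTop_nhds_zero_nat
  have hbd : ∀ k, r k ∈ Metric.closedBall (0 : ι → ℂ) (‖diagonal l‖ + 1) := by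
    intro k
    rw [mem_closedBall_zero_iff, pi_norm_le_iff_of_nonneg (by positivity)]
    intro i
    have h1 : ‖A k‖ ≤ ‖diagonal l‖ + ‖A k - diagonal l‖ := by
      simpa using norm_add_le (diagonal l) (A k - diagonal l)
    have h2 : 1 / ((k : ℝ) + 1) ≤ 1 := by
      rw [div_le_one (by positivity)]
      linarith [k.cast_nonneg (α := ℝ)]
    linarith [norm_diagonalization_le (hG k) (hAG k) i, hA k]
  obtain ⟨s, -, φ, hφ, hs⟩ := (isCompact_closedBall _ _).tendsto_subseq hbd
  -- The eigenvector matrices `G k` are not controlled; only the characteristic polynomial passes to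
  -- the limit.
  have hdet : ∀ z : ℂ, ∏ i, (z - s i) = ∏ i, (z - l i) := by
    intro z
    have hc : Continuous fun M : Matrix ι ι ℂ => (diagonal (fun _ => z) - M).det := by fun_prop
    have h1 := (hc.tendsto _).comp (hlim.comp hφ.tendsto_atTop)
    have hc2 : Continuous fun t : ι → ℂ => ∏ i, (z - t i) := by fun_prop
    have h2 := (hc2.tendsto _).comp hs
    have h3 : (diagonal (fun _ => z) - diagonal l).det = ∏ i, (z - l i) := by
      rw [diagonal_sub, det_diagonal]
    rw [← h3]
    refine tendsto_nhds_unique h2 (h1.congr fun k => ?_)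
    exact det_scalar_sub_of_diagonalization (hG _) (hAG _) z
  obtain ⟨σ, hσ⟩ := exists_perm_of_prod_sub_eq hdet
  have hev : ∀ᶠ k in atTop, ‖r (φ k) - s‖ < η := by
    have := (tendsto_iff_norm_sub_tendsto_zero.mp hs).eventually_lt_const hη
    simpa using this
  obtain ⟨k, hk⟩ := hev.exists
  obtain ⟨i, hi⟩ := hr (φ k) σ
  rw [← hσ i] at hi
  exact absurd (norm_le_pi_norm (r (φ k) - s) (σ i)) (by simpa using hk.trans_le hi)

end Eigenvalues

/-! ### The coupled pencil `(Λ + L Λ₃ M, 1 + L M)` -/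

section Pencil

variable {a b c : Type*} [Fintype a] [Fintype b] [Fintype c]
  [DecidableEq a] [DecidableEq b] [DecidableEq c]

/-- Norm bounds for the off-diagonal coupling matrices `L`, `M`: the leading blocks are bounded
by `e`, the trailing ones by `d`. -/
structure GradedBound (L : Matrix (a ⊕ b) c ℂ) (M : Matrix c (a ⊕ b) ℂ) (e d : ℝ) : Prop where
  rows₁ : ‖L.toRows₁‖ ≤ e
  rows₂ : ‖L.toRows₂‖ ≤ d
  cols₁ : ‖M.toCols₁‖ ≤ e
  cols₂ : ‖M.toCols₂‖ ≤ d

namespace GradedBound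

variable {L : Matrix (a ⊕ b) c ℂ} {M : Matrix c (a ⊕ b) ℂ} {e d : ℝ}

lemma nonneg_left (h : GradedBound L M e d) : 0 ≤ e := (norm_nonneg _).trans h.rows₁

lemma nonneg_right (h : GradedBound L M e d) : 0 ≤ d := (norm_nonneg _).trans h.rows₂

lemma transpose (h : GradedBound L M e d) : GradedBound Mᵀ Lᵀ e d where
  rows₁ := (norm_transpose_le M.toCols₁).trans h.cols₁
  rows₂ := (norm_transpose_le M.toCols₂).trans h.cols₂
  cols₁ := (norm_transpose_le L.toRows₁).trans h.rows₁
  cols₂ := (norm_transpose_le L.toRows₂).trans h.rows₂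

lemma norm_rows_le (h : GradedBound L M e d) : ‖L‖ ≤ e + d := by
  refine norm_le_of_l2norm_mulVec_le (add_nonneg h.nonneg_left h.nonneg_right) fun v => ?_
  have hv : L *ᵥ v = Sum.elim (L.toRows₁ *ᵥ v) (L.toRows₂ *ᵥ v) := by
    rw [← fromRows_mulVec, fromRows_toRows]
  have h0 := l2norm_nonneg v
  calc l2norm (L *ᵥ v) ≤ ‖L.toRows₁‖ * l2norm v + ‖L.toRows₂‖ * l2norm v := by
        rw [hv]
        exact (l2norm_sumElim_le _ _).trans
          (add_le_add (l2norm_mulVec_le _ _) (l2norm_mulVec_le _ _))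
    _ ≤ (e + d) * l2norm v := by
        rw [add_mul]
        gcongr
        exacts [h.rows₁, h.rows₂]

lemma norm_cols_le (h : GradedBound L M e d) : ‖M‖ ≤ e + d :=
  (norm_transpose_le Mᵀ).trans h.transpose.norm_rows_le

end GradedBound

/-- `g` is an eigenvector with eigenvalue `z` of the pencil
`(diag Λ + L diag l₃ M, 1 + L M)`. -/
def IsPencilEigenvector (Λ : a ⊕ b → ℂ) (l₃ : c → ℂ) (L : Matrix (a ⊕ b) c ℂ)
    (M : Matrix c (a ⊕ b) ℂ) (z : ℂ) (g : a ⊕ b → ℂ) : Prop :=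
  ∀ i, (Λ i - z) * g i = (L *ᵥ fun j => (z - l₃ j) * (M *ᵥ g) j) i

lemma isPencilEigenvector_of_mulVec {Λ : a ⊕ b → ℂ} {l₃ : c → ℂ} {L : Matrix (a ⊕ b) c ℂ}
    {M : Matrix c (a ⊕ b) ℂ} {z : ℂ} {g : a ⊕ b → ℂ}
    (h : (diagonal Λ + L * diagonal l₃ * M) *ᵥ g = z • ((1 + L * M) *ᵥ g)) :
    IsPencilEigenvector Λ l₃ L M z g := by
  intro i
  have hi := congrFun h i
  simp only [add_mulVec, one_mulVec, ← mulVec_mulVec, Pi.add_apply, Pi.smul_apply,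
    mulVec_diagonal, smul_eq_mul] at hi
  have h2 : (fun j => (z - l₃ j) * (M *ᵥ g) j) =
      z • (M *ᵥ g) - diagonal l₃ *ᵥ (M *ᵥ g) := by
    ext j
    rw [Pi.sub_apply, Pi.smul_apply, mulVec_diagonal, smul_eq_mul, sub_mul]
  rw [h2, mulVec_sub, mulVec_smul, Pi.sub_apply, Pi.smul_apply, smul_eq_mul]
  linear_combination hi

namespace IsPencilEigenvector

variable {Λ : a ⊕ b → ℂ} {l₃ : c → ℂ} {L : Matrix (a ⊕ b) c ℂ} {M : Matrix c (a ⊕ b) ℂ}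
  {z : ℂ} {g : a ⊕ b → ℂ} {e d R γ : ℝ}

/-- An absorption argument: the trailing equations and the separation `γ` bound the trailing part of
`g` by `d R ‖M g‖ / γ`. Its contribution to `M g` is then at most half of `‖M g‖` by `hd`, which
leaves `‖M g‖` controlled by the leading part of `g` alone. -/
lemma l2norm_bounds (h : IsPencilEigenvector Λ l₃ L M z g) (hLM : GradedBound L M e d)
    (hR : 0 ≤ R) (hz : ∀ j, ‖z - l₃ j‖ ≤ R) (hγ : 0 < γ)
    (hsep : ∀ j, γ ≤ ‖Λ (Sum.inr j) - z‖) (hd : 2 * d ^ 2 * R ≤ γ) :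
    l2norm (M *ᵥ g) ≤ 2 * e * l2norm (g ∘ Sum.inl) ∧
    l2norm (fun i => (Λ (Sum.inl i) - z) * g (Sum.inl i))
      ≤ 2 * R * e ^ 2 * l2norm (g ∘ Sum.inl) ∧
    l2norm (fun i => (Λ (Sum.inr i) - z) * g (Sum.inr i))
      ≤ 2 * R * d * e * l2norm (g ∘ Sum.inl) ∧
    γ * l2norm (g ∘ Sum.inr) ≤ 2 * R * d * e * l2norm (g ∘ Sum.inl) := by
  have he := hLM.nonneg_left
  have hd0 := hLM.nonneg_right
  set w : c → ℂ := fun j => (z - l₃ j) * (M *ᵥ g) j with hw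
  have hwN : l2norm w ≤ R * l2norm (M *ᵥ g) := l2norm_mul_le hR hz
  have h1 : (fun i => (Λ (Sum.inl i) - z) * g (Sum.inl i)) = L.toRows₁ *ᵥ w :=
    funext fun i => h (Sum.inl i)
  have h2 : (fun i => (Λ (Sum.inr i) - z) * g (Sum.inr i)) = L.toRows₂ *ᵥ w :=
    funext fun i => h (Sum.inr i)
  have hMg : M *ᵥ g = M.toCols₁ *ᵥ (g ∘ Sum.inl) + M.toCols₂ *ᵥ (g ∘ Sum.inr) := by
    rw [← fromCols_mulVec, fromCols_toCols]
  have hx1 := l2norm_nonneg (g ∘ Sum.inl)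
  have hx2 := l2norm_nonneg (g ∘ Sum.inr)
  have hN0 := l2norm_nonneg (M *ᵥ g)
  have hNle : l2norm (M *ᵥ g) ≤ e * l2norm (g ∘ Sum.inl) + d * l2norm (g ∘ Sum.inr) := by
    conv_lhs => rw [hMg]
    refine (l2norm_add_le _ _).trans
      (add_le_add ((l2norm_mulVec_le _ _).trans ?_) ((l2norm_mulVec_le _ _).trans ?_))
    · gcongr
      exact hLM.cols₁
    · gcongr
      exact hLM.cols₂
  have hb1 : l2norm (L.toRows₁ *ᵥ w) ≤ e * (R * l2norm (M *ᵥ g)) := by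
    refine (l2norm_mulVec_le _ _).trans ?_
    gcongr
    · exact l2norm_nonneg w
    · exact hLM.rows₁
  have hb2 : l2norm (L.toRows₂ *ᵥ w) ≤ d * (R * l2norm (M *ᵥ g)) := by
    refine (l2norm_mulVec_le _ _).trans ?_
    gcongr
    · exact l2norm_nonneg w
    · exact hLM.rows₂
  have hlow : γ * l2norm (g ∘ Sum.inr) ≤ l2norm (L.toRows₂ *ᵥ w) := by
    rw [← h2]
    exact le_l2norm_mul hγ.le hsep
  have hdx2 : 2 * (d * l2norm (g ∘ Sum.inr)) ≤ l2norm (M *ᵥ g) := by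
    refine le_of_mul_le_mul_left ?_ hγ
    calc γ * (2 * (d * l2norm (g ∘ Sum.inr))) = 2 * d * (γ * l2norm (g ∘ Sum.inr)) := by ring
      _ ≤ 2 * d * (d * (R * l2norm (M *ᵥ g))) :=
          mul_le_mul_of_nonneg_left (hlow.trans hb2) (by positivity)
      _ = 2 * d ^ 2 * R * l2norm (M *ᵥ g) := by ring
      _ ≤ γ * l2norm (M *ᵥ g) := by gcongr
  have hN : l2norm (M *ᵥ g) ≤ 2 * e * l2norm (g ∘ Sum.inl) := by linarith
  have hb2' : l2norm (L.toRows₂ *ᵥ w) ≤ 2 * R * d * e * l2norm (g ∘ Sum.inl) := by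
    refine hb2.trans ?_
    calc d * (R * l2norm (M *ᵥ g)) ≤ d * (R * (2 * e * l2norm (g ∘ Sum.inl))) := by gcongr
      _ = _ := by ring
  refine ⟨hN, ?_, ?_, hlow.trans hb2'⟩
  · rw [h1]
    refine hb1.trans ?_
    calc e * (R * l2norm (M *ᵥ g)) ≤ e * (R * (2 * e * l2norm (g ∘ Sum.inl))) := by gcongr
      _ = _ := by ring
  · rw [h2]
    exact hb2'

lemma l2norm_leading_pos (h : IsPencilEigenvector Λ l₃ L M z g) (hg : g ≠ 0)
    (hLM : GradedBound L M e d)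
    (hR : 0 ≤ R) (hz : ∀ j, ‖z - l₃ j‖ ≤ R) (hγ : 0 < γ)
    (hsep : ∀ j, γ ≤ ‖Λ (Sum.inr j) - z‖) (hd : 2 * d ^ 2 * R ≤ γ) :
    0 < l2norm (g ∘ Sum.inl) := by
  refine lt_of_le_of_ne (l2norm_nonneg _) fun h0 => hg ?_
  have h1 := (h.l2norm_bounds hLM hR hz hγ hsep hd).2.2.2
  rw [← h0, mul_zero] at h1
  have h2 : l2norm (g ∘ Sum.inr) = 0 :=
    le_antisymm (nonpos_of_mul_nonpos_right h1 hγ) (l2norm_nonneg _)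
  rw [← Sum.elim_comp_inl_inr g, l2norm_eq_zero.mp h0.symm, l2norm_eq_zero.mp h2]
  exact Sum.elim_zero_zero

/-- Quadratic accuracy of an eigenvalue of the pencil. -/
lemma eigenvalue_bound (h : IsPencilEigenvector Λ l₃ L M z g) (hg : g ≠ 0)
    (hLM : GradedBound L M e d)
    (hR : 0 ≤ R) (hz : ∀ j, ‖z - l₃ j‖ ≤ R) (hγ : 0 < γ)
    (hsep : ∀ j, γ ≤ ‖Λ (Sum.inr j) - z‖) (hd : 2 * d ^ 2 * R ≤ γ)
    {j : a} (hj : ∀ i, ‖Λ (Sum.inl j) - z‖ ≤ ‖Λ (Sum.inl i) - z‖) :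
    ‖z - Λ (Sum.inl j)‖ ≤ 2 * R * e ^ 2 := by
  have hpos := h.l2norm_leading_pos hg hLM hR hz hγ hsep hd
  rw [norm_sub_rev]
  -- The smallest leading `‖Λ i - z‖` is attained at `j`, so it can be pulled out of the diagonal
  -- action on the leading part of `g` and that part cancelled.
  refine le_of_mul_le_mul_right ?_ hpos
  exact (le_l2norm_mul (norm_nonneg _) hj).trans
    (h.l2norm_bounds hLM hR hz hγ hsep hd).2.1

/-- Linear accuracy of the residual of an eigenvector of the pencil. -/
lemma residual_bound (h : IsPencilEigenvector Λ l₃ L M z g)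
    (hLM : GradedBound L M e d)
    (hR : 0 ≤ R) (hz : ∀ j, ‖z - l₃ j‖ ≤ R) (hγ : 0 < γ)
    (hsep : ∀ j, γ ≤ ‖Λ (Sum.inr j) - z‖) (hd : 2 * d ^ 2 * R ≤ γ) :
    l2norm (fun x => (Sum.elim Λ l₃ x - z) * Sum.elim g (M *ᵥ g) x) ≤
      2 * R * e * (e + d + 1) * l2norm (Sum.elim g (M *ᵥ g)) := by
  obtain ⟨h1, h2, h3, -⟩ := h.l2norm_bounds hLM hR hz hγ hsep hd
  have he := hLM.nonneg_left
  have hd0 := hLM.nonneg_right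
  have hsplit : (fun x => (Sum.elim Λ l₃ x - z) * Sum.elim g (M *ᵥ g) x) =
      Sum.elim (Sum.elim (fun i => (Λ (Sum.inl i) - z) * g (Sum.inl i))
        (fun i => (Λ (Sum.inr i) - z) * g (Sum.inr i)))
        (fun j => (l₃ j - z) * (M *ᵥ g) j) := by
    ext ((i | i) | i) <;> rfl
  have h4 : l2norm (fun j => (l₃ j - z) * (M *ᵥ g) j) ≤ R * l2norm (M *ᵥ g) :=
    l2norm_mul_le hR fun j => by
      rw [norm_sub_rev]
      exact hz j
  have h5 : l2norm (g ∘ Sum.inl) ≤ l2norm (Sum.elim g (M *ᵥ g)) :=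
    (l2norm_comp_inl_le g).trans (l2norm_le_sumElim_left _ _)
  rw [hsplit]
  calc _ ≤ 2 * R * e ^ 2 * l2norm (g ∘ Sum.inl) + 2 * R * d * e * l2norm (g ∘ Sum.inl)
        + R * (2 * e * l2norm (g ∘ Sum.inl)) := by
        refine (l2norm_sumElim_le _ _).trans (add_le_add
          ((l2norm_sumElim_le _ _).trans (add_le_add h2 h3)) (h4.trans ?_))
        gcongr
    _ = 2 * R * e * (e + d + 1) * l2norm (g ∘ Sum.inl) := by ring
    _ ≤ _ := by gcongr

end IsPencilEigenvector

/-- The reduced matrix `(1 + L M)⁻¹ (diag Λ + L diag l₃ M)`. -/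
noncomputable def pencilMatrix (Λ : a ⊕ b → ℂ) (l₃ : c → ℂ) (L : Matrix (a ⊕ b) c ℂ)
    (M : Matrix c (a ⊕ b) ℂ) : Matrix (a ⊕ b) (a ⊕ b) ℂ :=
  (1 + L * M)⁻¹ * (diagonal Λ + L * diagonal l₃ * M)

/-- With `b = 1 + L M`, the difference is `b⁻¹ L (Λ₃ M - M Λ)`, and `b⁻¹ L = L (1 - M b⁻¹ L)`.
Moving `L` to the far left matters: its row grading becomes that of the difference, whereas `b⁻¹` in
front would mix the rows. -/
lemma pencilMatrix_sub_diagonal (Λ : a ⊕ b → ℂ) (l₃ : c → ℂ) {L : Matrix (a ⊕ b) c ℂ}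
    {M : Matrix c (a ⊕ b) ℂ} (h : IsUnit (1 + L * M).det) :
    pencilMatrix Λ l₃ L M - diagonal Λ =
      L * (1 - M * (1 + L * M)⁻¹ * L) * (diagonal l₃ * M - M * diagonal Λ) := by
  have h1 : (1 + L * M)⁻¹ * L = L * (1 - M * (1 + L * M)⁻¹ * L) := by
    have h2 : (1 + L * M) * (1 + L * M)⁻¹ = 1 := mul_nonsing_inv _ h
    rw [add_mul, one_mul] at h2
    calc (1 + L * M)⁻¹ * L = ((1 + L * M)⁻¹ + L * M * (1 + L * M)⁻¹) * L
          - L * M * (1 + L * M)⁻¹ * L := by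
          rw [Matrix.add_mul, add_sub_cancel_right]
      _ = _ := by
        rw [h2]
        simp only [Matrix.mul_sub, Matrix.one_mul, Matrix.mul_one, Matrix.mul_assoc]
  have h3 : (1 + L * M)⁻¹ * (1 + L * M) = 1 := nonsing_inv_mul _ h
  rw [← h1, pencilMatrix]
  calc _ = (1 + L * M)⁻¹ * (diagonal Λ + L * diagonal l₃ * M)
        - (1 + L * M)⁻¹ * (1 + L * M) * diagonal Λ := by rw [h3, Matrix.one_mul]
    _ = _ := by
      simp only [Matrix.mul_add, Matrix.add_mul, Matrix.mul_sub, Matrix.mul_one, Matrix.mul_assoc]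
      abel

end Pencil

/-! ### Uniform constants -/

lemma exists_pos_forall_le {κ : Type*} [Finite κ] (f : κ → ℝ) (hf : ∀ i, 0 < f i) :
    ∃ g > 0, ∀ i, g ≤ f i := by
  obtain ⟨g, hg⟩ := Finite.exists_ge (α := {x : ℝ // 0 < x}) fun i => ⟨f i, hf i⟩
  exact ⟨g, g.2, hg⟩

lemma exists_half_gap {ι : Type*} [Finite ι] (l : ι → ℂ) :
    ∃ g > 0, ∀ i j, l i ≠ l j → 2 * g ≤ ‖l i - l j‖ := by
  obtain ⟨g, hg, h⟩ := exists_pos_forall_le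
    (fun x : {x : ι × ι // l x.1 ≠ l x.2} => ‖l x.1.1 - l x.1.2‖ / 2)
    fun x => half_pos (norm_pos_iff.mpr (sub_ne_zero.mpr x.2))
  refine ⟨g, hg, fun i j hij => ?_⟩
  have := h ⟨(i, j), hij⟩
  simp only at this
  linarith

/-- Only finitely many `k` have `δ ^ k` not small, and for these `ε ^ k` is bounded below when `ε >
0`. When `ε = 0`, also `δ = 0`, and every `k ≥ 1` is in the small case. -/
lemma pow_lt_or_le_pow {ε δ τ : ℝ} (hε : 0 ≤ ε) (hεδ : ε ≤ δ) (hδ : δ < 1) (h0 : ε = 0 → δ = 0)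
    (hτ : 0 < τ) : ∃ θ > 0, ∀ k : ℕ, 1 ≤ k → δ ^ k < τ ∨ θ ≤ ε ^ k := by
  rcases hε.eq_or_lt with h | h
  · refine ⟨1, one_pos, fun k hk => Or.inl ?_⟩
    rw [h0 h.symm, zero_pow (by omega)]
    exact hτ
  · obtain ⟨N, hN⟩ := exists_pow_lt_of_lt_one hτ hδ
    refine ⟨ε ^ N, pow_pos h N, fun k _ => ?_⟩
    rcases le_total N k with hk | hk
    · exact Or.inl ((pow_le_pow_of_le_one (hε.trans hεδ) hδ.le hk).trans_lt hN)
    · exact Or.inr (pow_le_pow_of_le_one hε (hεδ.trans hδ.le) hk)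

/-- Inversion is continuous at `1`, and a convergent sequence is bounded from its first term on. The
finitely many possibly singular terms do no harm, since the inverse is total. -/
lemma exists_norm_inv_le {ι : Type*} [Fintype ι] [DecidableEq ι] {E : ℕ → Matrix ι ι ℂ}
    (hE : Tendsto E atTop (𝓝 0)) : ∃ κ, 0 ≤ κ ∧ ∀ k, ‖(1 + E k)⁻¹‖ ≤ κ := by
  have h1 : Tendsto (fun k => 1 + E k) atTop (𝓝 ((1 : (Matrix ι ι ℂ)ˣ) : Matrix ι ι ℂ)) := by
    simpa using hE.const_add 1
  have h2 := (NormedRing.inverse_continuousAt (1 : (Matrix ι ι ℂ)ˣ)).tendsto.comp h1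
  obtain ⟨κ, hκ⟩ := isBounded_iff_forall_norm_le.mp (Metric.isBounded_range_of_tendsto _ h2)
  have h3 : ∀ k, ‖(1 + E k)⁻¹‖ ≤ κ := fun k => by
    rw [nonsing_inv_eq_ringInverse]
    exact hκ _ ⟨k, rfl⟩
  exact ⟨κ, (norm_nonneg _).trans (h3 0), h3⟩

/-! ### Convergence rates for a sequence of graded pencils -/

section Sequence

variable {a b c : Type*} [Fintype a] [Fintype b] [Fintype c]
  [DecidableEq a] [DecidableEq b] [DecidableEq c]
  {L : ℕ → Matrix (a ⊕ b) c ℂ} {M : ℕ → Matrix c (a ⊕ b) ℂ} {D ε δ : ℝ}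

lemma norm_diagonal_mul_sub_mul_diagonal_le {ι κ : Type*} [Fintype ι] [Fintype κ]
    [DecidableEq ι] [DecidableEq κ] (l : ι → ℂ) (l' : κ → ℂ) (M : Matrix ι κ ℂ) :
    ‖diagonal l * M - M * diagonal l'‖ ≤ (‖l‖ + ‖l'‖) * ‖M‖ := by
  refine (norm_sub_le _ _).trans ?_
  have h1 := l2_opNorm_mul (diagonal l) M
  have h2 := l2_opNorm_mul M (diagonal l')
  rw [l2_opNorm_diagonal] at h1 h2
  linarith

lemma norm_mul_mul_le {ι κ μ ν : Type*} [Fintype ι] [Fintype κ] [Fintype μ] [Fintype ν]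
    [DecidableEq κ] [DecidableEq μ] [DecidableEq ν]
    {P : Matrix ι κ ℂ} {K : Matrix κ μ ℂ} {Q : Matrix μ ν ℂ} {x y z : ℝ}
    (hP : ‖P‖ ≤ x) (hK : ‖K‖ ≤ y) (hQ : ‖Q‖ ≤ z) : ‖P * K * Q‖ ≤ x * y * z := by
  have hx := (norm_nonneg P).trans hP
  have hy := (norm_nonneg K).trans hK
  calc ‖P * K * Q‖ ≤ ‖P * K‖ * ‖Q‖ := l2_opNorm_mul _ _
    _ ≤ ‖P‖ * ‖K‖ * ‖Q‖ := by
        gcongr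
        exact l2_opNorm_mul _ _
    _ ≤ x * y * z := by gcongr

/-- The reduced matrices converge to `diag Λ`, with the convergence rates of their blocks. -/
lemma exists_pencilMatrix_bound (Λ : a ⊕ b → ℂ) (l₃ : c → ℂ)
    (hLM : ∀ k, GradedBound (L k) (M k) (D * ε ^ k) (D * δ ^ k))
    (hD : 0 ≤ D) (hε : 0 ≤ ε) (hεδ : ε ≤ δ) (hδ : δ < 1) :
    ∃ C, 0 ≤ C ∧ ∀ k, IsUnit (1 + L k * M k).det →
      ‖(pencilMatrix Λ l₃ (L k) (M k)).toBlocks₁₁ - diagonal (Λ ∘ Sum.inl)‖ ≤ C * (ε ^ k) ^ 2 ∧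
      ‖(pencilMatrix Λ l₃ (L k) (M k)).toBlocks₂₁‖ ≤ C * ε ^ k ∧
      ‖(pencilMatrix Λ l₃ (L k) (M k)).toBlocks₁₂‖ ≤ C * ε ^ k ∧
      ‖pencilMatrix Λ l₃ (L k) (M k) - diagonal Λ‖ ≤ C * δ ^ k := by
  have hδ0 : 0 ≤ δ := hε.trans hεδ
  have hpow : ∀ k, ε ^ k ≤ δ ^ k := fun k => pow_le_pow_left₀ hε hεδ k
  have hδ1 : ∀ k, δ ^ k ≤ 1 := fun k => pow_le_one₀ hδ0 hδ.le
  have hL : ∀ k, ‖L k‖ ≤ 2 * D * δ ^ k := fun k => by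
    linarith [(hLM k).norm_rows_le, mul_le_mul_of_nonneg_left (hpow k) hD]
  have hM : ∀ k, ‖M k‖ ≤ 2 * D * δ ^ k := fun k => by
    linarith [(hLM k).norm_cols_le, mul_le_mul_of_nonneg_left (hpow k) hD]
  have hL1 : ∀ k, ‖L k‖ ≤ 2 * D := fun k =>
    (hL k).trans (mul_le_of_le_one_right (by positivity) (hδ1 k))
  have hM1 : ∀ k, ‖M k‖ ≤ 2 * D := fun k =>
    (hM k).trans (mul_le_of_le_one_right (by positivity) (hδ1 k))
  have hE : Tendsto (fun k => L k * M k) atTop (𝓝 0) := by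
    refine squeeze_zero_norm (a := fun k => 2 * D * (2 * D) * δ ^ k) (fun k => ?_) ?_
    · calc ‖L k * M k‖ ≤ ‖L k‖ * ‖M k‖ := l2_opNorm_mul _ _
        _ ≤ 2 * D * (2 * D * δ ^ k) := by
            gcongr
            exacts [hL1 k, hM k]
        _ = _ := by ring
    · simpa using (tendsto_pow_atTop_nhds_zero_of_lt_one hδ0 hδ).const_mul (2 * D * (2 * D))
  obtain ⟨κ, hκ0, hκ⟩ := exists_norm_inv_le hE
  set N : ℝ := ‖(1 : Matrix c c ℂ)‖ + 2 * D * κ * (2 * D) with hN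
  have hN0 : 0 ≤ N := by positivity
  have hK : ∀ k, ‖1 - M k * (1 + L k * M k)⁻¹ * L k‖ ≤ N := fun k =>
    (norm_sub_le _ _).trans (add_le_add le_rfl (norm_mul_mul_le (hM1 k) (hκ k) (hL1 k)))
  set R : ℝ := ‖l₃‖ + ‖Λ‖ with hR
  have hR0 : 0 ≤ R := by positivity
  have hΛ1 : ‖Λ ∘ Sum.inl‖ ≤ ‖Λ‖ :=
    (pi_norm_le_iff_of_nonneg (norm_nonneg _)).mpr fun i => norm_le_pi_norm Λ _
  have hΛ2 : ‖Λ ∘ Sum.inr‖ ≤ ‖Λ‖ :=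
    (pi_norm_le_iff_of_nonneg (norm_nonneg _)).mpr fun i => norm_le_pi_norm Λ _
  set Q : ℕ → Matrix c (a ⊕ b) ℂ := fun k => diagonal l₃ * M k - M k * diagonal Λ with hQ
  have hQ1 : ∀ k, ‖(Q k).toCols₁‖ ≤ R * (D * ε ^ k) := fun k => by
    have h1 : (Q k).toCols₁ =
        diagonal l₃ * (M k).toCols₁ - (M k).toCols₁ * diagonal (Λ ∘ Sum.inl) := by
      ext i j
      simp [hQ]
    rw [h1]
    refine (norm_diagonal_mul_sub_mul_diagonal_le _ _ _).trans ?_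
    gcongr
    exacts [by rw [hR]; gcongr, (hLM k).cols₁]
  have hQ2 : ∀ k, ‖(Q k).toCols₂‖ ≤ R * (D * δ ^ k) := fun k => by
    have h1 : (Q k).toCols₂ =
        diagonal l₃ * (M k).toCols₂ - (M k).toCols₂ * diagonal (Λ ∘ Sum.inr) := by
      ext i j
      simp [hQ]
    rw [h1]
    refine (norm_diagonal_mul_sub_mul_diagonal_le _ _ _).trans ?_
    gcongr
    exacts [by rw [hR]; gcongr, (hLM k).cols₂]
  have hQ0 : ∀ k, ‖Q k‖ ≤ R * (2 * D) := fun k => by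
    refine (norm_diagonal_mul_sub_mul_diagonal_le _ _ _).trans ?_
    gcongr
    exact hM1 k
  -- The factor `4` is needed only for the last bound, where both `L k` and `M k` enter with norm
  -- bound `2 * D`; the block estimates need `D` each.
  refine ⟨4 * (D * N * (R * D)), by positivity, fun k hk => ?_⟩
  have hC : 0 ≤ D * N * (R * D) := by positivity
  have key := pencilMatrix_sub_diagonal Λ l₃ hk
  set K := 1 - M k * (1 + L k * M k)⁻¹ * L k with hKdef
  set A' := pencilMatrix Λ l₃ (L k) (M k) with hA'
  have hA'' : A' = diagonal Λ + L k * K * Q k := by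
    rw [← sub_eq_iff_eq_add', key]
  have h11 : A'.toBlocks₁₁ - diagonal (Λ ∘ Sum.inl) = (L k).toRows₁ * K * (Q k).toCols₁ := by
    ext i j
    rw [hA'']
    simp [toBlocks₁₁, mul_apply, diagonal_apply]
  have h21 : A'.toBlocks₂₁ = (L k).toRows₂ * K * (Q k).toCols₁ := by
    ext i j
    rw [hA'']
    simp [toBlocks₂₁, mul_apply]
  have h12 : A'.toBlocks₁₂ = (L k).toRows₁ * K * (Q k).toCols₂ := by
    ext i j
    rw [hA'']
    simp [toBlocks₁₂, mul_apply]
  have hεk : 0 ≤ ε ^ k := pow_nonneg hε k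
  have hδk : 0 ≤ δ ^ k := pow_nonneg hδ0 k
  refine ⟨?_, ?_, ?_, ?_⟩
  · rw [h11]
    refine (norm_mul_mul_le (hLM k).rows₁ (hK k) (hQ1 k)).trans ?_
    have : 0 ≤ D * N * (R * D) * (ε ^ k) ^ 2 := by positivity
    linear_combination 3 * this
  · rw [h21]
    refine (norm_mul_mul_le (hLM k).rows₂ (hK k) (hQ1 k)).trans ?_
    have h1 : D * N * (R * D) * ε ^ k * δ ^ k ≤ D * N * (R * D) * ε ^ k :=
      mul_le_of_le_one_right (by positivity) (hδ1 k)
    have : 0 ≤ D * N * (R * D) * ε ^ k := by positivity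
    linear_combination h1 + 3 * this
  · rw [h12]
    refine (norm_mul_mul_le (hLM k).rows₁ (hK k) (hQ2 k)).trans ?_
    have h1 : D * N * (R * D) * ε ^ k * δ ^ k ≤ D * N * (R * D) * ε ^ k :=
      mul_le_of_le_one_right (by positivity) (hδ1 k)
    have : 0 ≤ D * N * (R * D) * ε ^ k := by positivity
    linear_combination h1 + 3 * this
  · rw [key]
    refine (norm_mul_mul_le (hL k) (hK k) (hQ0 k)).trans (le_of_eq ?_)
    ring

/-- Convergence of eigenvalues and of the residuals of right and left eigenvectors of the
reduced pencils. -/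
lemma exists_eigenpair_bound (Λ : a ⊕ b → ℂ) (l₃ : c → ℂ)
    (hsep : ∀ i j, Λ (Sum.inl i) ≠ Λ (Sum.inr j))
    (hLM : ∀ k, GradedBound (L k) (M k) (D * ε ^ k) (D * δ ^ k))
    (hD : 0 ≤ D) (hε : 0 ≤ ε) (hεδ : ε ≤ δ) (hδ : δ < 1) (h0 : ε = 0 → δ = 0) :
    ∃ C, 0 ≤ C ∧ ∀ k, 1 ≤ k → IsUnit (1 + L k * M k).det →
      ∀ (G H : Matrix (a ⊕ b) (a ⊕ b) ℂ) (r : a ⊕ b → ℂ), IsUnit G.det →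
      (diagonal Λ + L k * diagonal l₃ * M k) * G = (1 + L k * M k) * G * diagonal r →
      H * (diagonal Λ + L k * diagonal l₃ * M k) = diagonal r * H * (1 + L k * M k) →
      ∃ s : a → a ⊕ b, Function.Injective s ∧ ∀ j,
        ‖r (s j) - Λ (Sum.inl j)‖ ≤ C * (ε ^ k) ^ 2 ∧
        l2norm (fun x => (Sum.elim Λ l₃ x - r (s j)) *
            Sum.elim (G.col (s j)) (M k *ᵥ G.col (s j)) x)
          ≤ C * ε ^ k * l2norm (Sum.elim (G.col (s j)) (M k *ᵥ G.col (s j))) ∧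
        l2norm (fun x => (Sum.elim Λ l₃ x - r (s j)) *
            Sum.elim (H.row (s j)) ((L k)ᵀ *ᵥ H.row (s j)) x)
          ≤ C * ε ^ k * l2norm (Sum.elim (H.row (s j)) ((L k)ᵀ *ᵥ H.row (s j))) := by
  obtain ⟨C₁, hC₁, hA⟩ := exists_pencilMatrix_bound Λ l₃ hLM hD hε hεδ hδ
  -- Since `g` is at most half the smallest gap, a Ritz value within `g` of one entry of `Λ` is at
  -- least `g` away from every different one.
  obtain ⟨g, hg, hgap⟩ := exists_half_gap Λ
  obtain ⟨τ, hτ, hmatch⟩ := exists_perm_eigenvalues_near_diagonal Λ hg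
  set R : ℝ := g + ‖Λ‖ + ‖l₃‖ with hR
  have hR0 : 0 ≤ R := by positivity
  have hδ0 : 0 ≤ δ := hε.trans hεδ
  have hpow : ∀ k, ε ^ k ≤ δ ^ k := fun k => pow_le_pow_left₀ hε hεδ k
  have hδ1 : ∀ k, δ ^ k ≤ 1 := fun k => pow_le_one₀ hδ0 hδ.le
  -- Below the first threshold the reduced matrix is close enough to `diagonal Λ` for matching;
  -- below the second, the absorption condition `2 * d ^ 2 * R ≤ g` holds. The summands `1` keep the
  -- denominators positive.
  obtain ⟨θ, hθ, hcase⟩ := pow_lt_or_le_pow hε hεδ hδ h0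
    (τ := min (τ / (C₁ + 1)) (g / (2 * D ^ 2 * R + 1))) (by positivity)
  set S : ℝ := C₁ + 2 * ‖Λ‖ + ‖l₃‖ with hS
  have hS0 : 0 ≤ S := by positivity
  -- The first two terms serve the eigenvalue and residual bounds for small `δ ^ k`; the last two
  -- serve the remaining `k`, where `S` bounds all `‖λ - z‖` and `θ ≤ ε ^ k`.
  refine ⟨2 * R * D ^ 2 + 2 * R * D * (2 * D + 1) + S / θ ^ 2 + S / θ, by positivity,
    fun k hk hunit G H r hG hGeq hHeq => ?_⟩
  set C := 2 * R * D ^ 2 + 2 * R * D * (2 * D + 1) + S / θ ^ 2 + S / θ with hC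
  have hεk : 0 ≤ ε ^ k := pow_nonneg hε k
  have hδk : 0 ≤ δ ^ k := pow_nonneg hδ0 k
  have hpg : ∀ i, IsPencilEigenvector Λ l₃ (L k) (M k) (r i) (G.col i) := fun i => by
    refine isPencilEigenvector_of_mulVec ?_
    ext j
    have := congrFun (congrFun hGeq j) i
    rw [mul_diagonal] at this
    simpa [mul_apply, mulVec, dotProduct, mul_comm] using this
  -- Transposing the pencil turns `L`, `M` into `Mᵀ`, `Lᵀ`, so rows of `H` are covered by the same
  -- estimates.
  have hph : ∀ i, IsPencilEigenvector Λ l₃ (M k)ᵀ (L k)ᵀ (r i) (H.row i) := fun i => by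
    refine isPencilEigenvector_of_mulVec ?_
    ext j
    have := congrFun (congrFun hHeq i) j
    rw [Matrix.mul_assoc (diagonal r), diagonal_mul] at this
    rw [Pi.smul_apply, smul_eq_mul]
    have e1 : diagonal Λ + (M k)ᵀ * diagonal l₃ * (L k)ᵀ =
        (diagonal Λ + L k * diagonal l₃ * M k)ᵀ := by
      simp [transpose_mul, Matrix.mul_assoc]
    have e2 : 1 + (M k)ᵀ * (L k)ᵀ = (1 + L k * M k)ᵀ := by simp [transpose_mul]
    rw [e1, e2, mulVec_transpose, mulVec_transpose]
    exact this
  have hAG : pencilMatrix Λ l₃ (L k) (M k) * G = G * diagonal r := by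
    rw [pencilMatrix, Matrix.mul_assoc, hGeq, Matrix.mul_assoc, ← Matrix.mul_assoc,
      nonsing_inv_mul _ hunit, Matrix.one_mul]
  have hAk := (hA k hunit).2.2.2
  rcases hcase k hk with hsmall | hlarge
  · have hs1 := hsmall.trans_le (min_le_left _ _)
    have hs2 := hsmall.trans_le (min_le_right _ _)
    rw [lt_div_iff₀ (by positivity)] at hs1 hs2
    have hd : 2 * (D * δ ^ k) ^ 2 * R ≤ g := by
      have : 2 * D ^ 2 * R * δ ^ k * δ ^ k ≤ 2 * D ^ 2 * R * δ ^ k :=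
        mul_le_of_le_one_right (by positivity) (hδ1 k)
      linear_combination this + hs2.le + hδk
    obtain ⟨σ, hσ⟩ := hmatch _ G r (hAk.trans_lt (by linarith)) hG hAG
    refine ⟨fun j => σ (Sum.inl j), σ.injective.comp Sum.inl_injective, fun j => ?_⟩
    set z := r (σ (Sum.inl j)) with hz
    have hzj : ‖z - Λ (Sum.inl j)‖ < g := hσ _
    have hfar : ∀ i, Λ i ≠ Λ (Sum.inl j) → g ≤ ‖Λ i - z‖ := fun i hi => by
      have h1 := hgap i (Sum.inl j) hi
      have h2 : ‖Λ i - Λ (Sum.inl j)‖ ≤ ‖Λ i - z‖ + ‖z - Λ (Sum.inl j)‖ :=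
        norm_sub_le_norm_sub_add_norm_sub _ _ _
      linarith
    have hzR : ∀ i, ‖z - l₃ i‖ ≤ R := fun i => by
      have h1 : ‖z - l₃ i‖ ≤ ‖z - Λ (Sum.inl j)‖ + ‖Λ (Sum.inl j) - l₃ i‖ :=
        norm_sub_le_norm_sub_add_norm_sub _ _ _
      have h2 := norm_sub_le (Λ (Sum.inl j)) (l₃ i)
      have h3 := norm_le_pi_norm Λ (Sum.inl j)
      have h4 := norm_le_pi_norm l₃ i
      linarith
    have hsep' : ∀ i, g ≤ ‖Λ (Sum.inr i) - z‖ := fun i => hfar _ (hsep j i).symm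
    -- Repeated wanted eigenvalues are allowed: equal entries of `Λ` tie, and different ones are
    -- farther away.
    have hmin : ∀ i, ‖Λ (Sum.inl j) - z‖ ≤ ‖Λ (Sum.inl i) - z‖ := fun i => by
      by_cases hi : Λ (Sum.inl i) = Λ (Sum.inl j)
      · rw [hi]
      · rw [norm_sub_rev]
        exact hzj.le.trans (hfar _ hi)
    have hCres : 2 * R * (D * ε ^ k) * (D * ε ^ k + D * δ ^ k + 1) ≤ C * ε ^ k := by
      have h1 : D * ε ^ k + D * δ ^ k + 1 ≤ 2 * D + 1 := by
        have := mul_le_mul_of_nonneg_left (hδ1 k) hD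
        have := mul_le_mul_of_nonneg_left (hpow k) hD
        linarith
      calc _ ≤ 2 * R * (D * ε ^ k) * (2 * D + 1) := by gcongr
        _ = 2 * R * D * (2 * D + 1) * ε ^ k := by ring
        _ ≤ C * ε ^ k := by
          gcongr
          have : 0 ≤ 2 * R * D ^ 2 + S / θ ^ 2 + S / θ := by positivity
          linarith
    refine ⟨?_, ?_, ?_⟩
    · refine ((hpg _).eigenvalue_bound (col_ne_zero hG _) (hLM k) hR0 hzR hg hsep' hd hmin).trans ?_
      calc 2 * R * (D * ε ^ k) ^ 2 = 2 * R * D ^ 2 * (ε ^ k) ^ 2 := by ring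
        _ ≤ C * (ε ^ k) ^ 2 := by
          gcongr
          have : 0 ≤ 2 * R * D * (2 * D + 1) + S / θ ^ 2 + S / θ := by positivity
          linarith
    · exact ((hpg _).residual_bound (hLM k) hR0 hzR hg hsep' hd).trans
        (mul_le_mul_of_nonneg_right hCres (l2norm_nonneg _))
    · exact ((hph _).residual_bound (hLM k).transpose hR0 hzR hg hsep' hd).trans
        (mul_le_mul_of_nonneg_right hCres (l2norm_nonneg _))
  -- Here any injective selection works, as all Ritz values satisfy the crude bound.
  · refine ⟨Sum.inl, Sum.inl_injective, fun j => ?_⟩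
    set z := r (Sum.inl j) with hz
    have hzb : ‖z‖ ≤ ‖Λ‖ + C₁ := by
      have h1 := norm_diagonalization_le hG hAG (Sum.inl j)
      have h2 : ‖pencilMatrix Λ l₃ (L k) (M k)‖ ≤
          ‖diagonal Λ‖ + ‖pencilMatrix Λ l₃ (L k) (M k) - diagonal Λ‖ := by
        simpa using norm_add_le (diagonal Λ) (pencilMatrix Λ l₃ (L k) (M k) - diagonal Λ)
      rw [l2_opNorm_diagonal] at h2
      have h3 := mul_le_of_le_one_right hC₁ (hδ1 k)
      linarith
    have hΛz : ∀ x, ‖Sum.elim Λ l₃ x - z‖ ≤ S := by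
      rintro (x | x)
      · have h1 := norm_sub_le (Λ x) z
        have h2 := norm_le_pi_norm Λ x
        have h3 := norm_nonneg l₃
        simp only [Sum.elim_inl]
        linarith
      · have h1 := norm_sub_le (l₃ x) z
        have h2 := norm_le_pi_norm l₃ x
        have h3 := norm_nonneg Λ
        simp only [Sum.elim_inr]
        linarith
    have hSε : S ≤ C * ε ^ k := by
      calc S = S / θ * θ := by field_simp
        _ ≤ C * ε ^ k := by
          gcongr
          have : 0 ≤ 2 * R * D ^ 2 + 2 * R * D * (2 * D + 1) + S / θ ^ 2 := by positivity
          linarith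
    refine ⟨?_, ?_, ?_⟩
    · have h1 : ‖z - Λ (Sum.inl j)‖ ≤ S := by
        rw [norm_sub_rev]
        exact hΛz (Sum.inl (Sum.inl j))
      refine h1.trans ?_
      calc S = S / θ ^ 2 * θ ^ 2 := by field_simp
        _ ≤ C * (ε ^ k) ^ 2 := by
          gcongr
          have : 0 ≤ 2 * R * D ^ 2 + 2 * R * D * (2 * D + 1) + S / θ := by positivity
          linarith
    · exact (l2norm_mul_le hS0 hΛz).trans (mul_le_mul_of_nonneg_right hSε (l2norm_nonneg _))
    · exact (l2norm_mul_le hS0 hΛz).trans (mul_le_mul_of_nonneg_right hSε (l2norm_nonneg _))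

end Sequence

/-! ### The iteration in eigenvector coordinates -/

section Run

variable {n p q : ℕ} {A B X Y : Matrix (Fin n) (Fin n) ℂ} {ev : Fin n → ℂ} {α β : Fin q → ℂ}

/-- `X` and `Yᴴ B` are mutually inverse, so `B⁻¹ A` and all its resolvents are diagonal in this
basis; none of the scalars `β l - ev j` vanishes. -/
lemma rightProj_eq (hB : IsUnit B.det) (hX : A * X = B * X * diagonal ev)
    (hY : Yᴴ * B * X = 1) (hβ : ∀ l j, β l ≠ ev j) :
    rightProj α β A B = X * diagonal (fun j => rho α β (ev j)) * (Yᴴ * B) := by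
  have hXY : X * (Yᴴ * B) = 1 := mul_eq_one_comm.mp hY
  have hM : B⁻¹ * A = X * diagonal ev * (Yᴴ * B) := by
    calc B⁻¹ * A = B⁻¹ * (A * X) * (Yᴴ * B) := by
          rw [Matrix.mul_assoc, Matrix.mul_assoc A, hXY, Matrix.mul_one]
      _ = B⁻¹ * B * (X * diagonal ev) * (Yᴴ * B) := by
          rw [hX]
          simp only [Matrix.mul_assoc]
      _ = _ := by rw [nonsing_inv_mul _ hB, Matrix.one_mul]
  have hinv : ∀ l, (β l • (1 : Matrix (Fin n) (Fin n) ℂ) - B⁻¹ * A)⁻¹ =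
      X * diagonal (fun j => (β l - ev j)⁻¹) * (Yᴴ * B) := fun l => by
    refine inv_eq_right_inv ?_
    have h1 : β l • (1 : Matrix (Fin n) (Fin n) ℂ) - B⁻¹ * A =
        X * diagonal (fun j => β l - ev j) * (Yᴴ * B) := by
      have h2 : diagonal (fun j => β l - ev j) =
          β l • (1 : Matrix (Fin n) (Fin n) ℂ) - diagonal ev := by
        rw [smul_one_eq_diagonal, diagonal_sub]
      rw [h2, hM, Matrix.mul_sub, Matrix.sub_mul, Matrix.mul_smul, Matrix.mul_one,
        Matrix.smul_mul, hXY]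
    rw [h1]
    calc _ = X * (diagonal (fun j => β l - ev j) * (Yᴴ * B * X) *
          diagonal (fun j => (β l - ev j)⁻¹)) * (Yᴴ * B) := by simp only [Matrix.mul_assoc]
      _ = X * (Yᴴ * B) := by
          rw [hY, Matrix.mul_one, diagonal_mul_diagonal]
          simp only [mul_inv_cancel₀ (sub_ne_zero.mpr (hβ l _)), diagonal_one, Matrix.mul_one]
      _ = 1 := hXY
  have hdiag : diagonal (fun j => rho α β (ev j)) =
      ∑ l, α l • diagonal (fun j => (β l - ev j)⁻¹) := by
    ext i j
    rw [Matrix.sum_apply]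
    by_cases hij : i = j
    · subst hij
      simp [rho, div_eq_mul_inv]
    · simp [hij]
  rw [rightProj, rhoMat, hdiag, Matrix.mul_sum, Matrix.sum_mul]
  refine Finset.sum_congr rfl fun l _ => ?_
  rw [hinv, Matrix.mul_smul, Matrix.smul_mul]

lemma conjTranspose_leftProj_mul (hB : IsUnit B.det) (hX : A * X = B * X * diagonal ev)
    (hY : Yᴴ * B * X = 1) (hβ : ∀ l j, β l ≠ ev j) (V : Matrix (Fin n) (Fin p) ℂ) :
    (leftProj α β A B * V)ᴴ =
      Vᴴ * B * X * diagonal (fun j => rho α β (ev j)) * Yᴴ := by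
  have h := rightProj_eq (α := α) hB hX hY hβ
  rw [rightProj] at h
  rw [leftProj, h, conjTranspose_mul, conjTranspose_mul, conjTranspose_mul,
    conjTranspose_conjTranspose, conjTranspose_conjTranspose, ← conjTranspose_nonsing_inv,
    conjTranspose_conjTranspose]
  have h1 : Vᴴ * (B * (X * diagonal (fun j => rho α β (ev j)) * (Yᴴ * B) * B⁻¹)) =
      Vᴴ * B * X * diagonal (fun j => rho α β (ev j)) * Yᴴ * (B * B⁻¹) := by
    simp only [Matrix.mul_assoc]
  rw [h1, mul_nonsing_inv _ hB, Matrix.mul_one]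

variable {U₀ V₀ : Matrix (Fin n) (Fin p) ℂ} {U V : ℕ → Matrix (Fin n) (Fin p) ℂ}
  {W Z : ℕ → Matrix (Fin p) (Fin p) ℂ} {ritz : ℕ → Fin p → ℂ}

/-- In eigenvector coordinates the iterates are `ρ(Λ)ᵏ` applied to the starting matrices, up to
an invertible change of basis. -/
lemma IsRun.exists_factorization (hrun : IsRun α β A B U₀ V₀ U V W Z ritz)
    (hB : IsUnit B.det) (hX : A * X = B * X * diagonal ev)
    (hY : Yᴴ * B * X = 1) (hβ : ∀ l j, β l ≠ ev j) :
    ∃ S T : ℕ → Matrix (Fin p) (Fin p) ℂ,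
      (∀ k, IsUnit (S k).det) ∧ (∀ k, IsUnit (T k).det) ∧
      (∀ k, S (k + 1) = S k * W (k + 1)) ∧ (∀ k, T (k + 1) = (Z (k + 1))ᴴ * T k) ∧
      (∀ k, U k = X * (diagonal (fun j => rho α β (ev j) ^ k) * (Yᴴ * B * U₀) * S k)) ∧
      (∀ k, (V k)ᴴ = T k * (V₀ᴴ * B * X * diagonal (fun j => rho α β (ev j) ^ k)) * Yᴴ) := by
  have hXY : X * (Yᴴ * B) = 1 := mul_eq_one_comm.mp hY
  have hBXY : B * (X * Yᴴ) = 1 := by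
    rw [← Matrix.mul_assoc, mul_eq_one_comm, ← Matrix.mul_assoc, hY]
  have hW : ∀ k, IsUnit (W (k + 1)).det := fun k =>
    isUnit_det_of_left_inverse (hrun.biorth k)
  have hZ : ∀ k, IsUnit ((Z (k + 1))ᴴ).det := fun k =>
    isUnit_det_of_right_inverse ((Matrix.mul_assoc _ _ _).symm.trans (hrun.biorth k))
  obtain ⟨S, hS₀, hS⟩ : ∃ S : ℕ → Matrix (Fin p) (Fin p) ℂ,
      S 0 = 1 ∧ ∀ k, S (k + 1) = S k * W (k + 1) :=
    ⟨fun k => Nat.rec 1 (fun k S => S * W (k + 1)) k, rfl, fun _ => rfl⟩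
  obtain ⟨T, hT₀, hT⟩ : ∃ T : ℕ → Matrix (Fin p) (Fin p) ℂ,
      T 0 = 1 ∧ ∀ k, T (k + 1) = (Z (k + 1))ᴴ * T k :=
    ⟨fun k => Nat.rec 1 (fun k T => (Z (k + 1))ᴴ * T) k, rfl, fun _ => rfl⟩
  refine ⟨S, T, fun k => ?_, fun k => ?_, hS, hT, fun k => ?_, fun k => ?_⟩
  · induction k with
    | zero => simp [hS₀]
    | succ k ih =>
      rw [hS, det_mul]
      exact ih.mul (hW k)
  · induction k with
    | zero => simp [hT₀]
    | succ k ih =>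
      rw [hT, det_mul]
      exact (hZ k).mul ih
  · induction k with
    | zero =>
      simp only [pow_zero, diagonal_one, Matrix.one_mul, Matrix.mul_one, hrun.initU, hS₀]
      rw [← Matrix.mul_assoc, hXY, Matrix.one_mul]
    | succ k ih =>
      rw [hrun.stepU, hS, ih, rightProj_eq hB hX hY hβ]
      have h1 : diagonal (fun j => rho α β (ev j) ^ (k + 1)) =
          diagonal (fun j => rho α β (ev j)) * diagonal (fun j => rho α β (ev j) ^ k) := by
        rw [diagonal_mul_diagonal]
        simp only [pow_succ']
      rw [h1]
      calc _ = X * diagonal (fun j => rho α β (ev j)) * (Yᴴ * B * X) *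
            (diagonal (fun j => rho α β (ev j) ^ k) * (Yᴴ * B * U₀) * S k * W (k + 1)) := by
            simp only [Matrix.mul_assoc]
        _ = _ := by
            rw [hY]
            simp only [Matrix.mul_assoc, Matrix.one_mul]
  · induction k with
    | zero =>
      simp only [pow_zero, diagonal_one, Matrix.one_mul, Matrix.mul_one, hrun.initV, hT₀]
      rw [Matrix.mul_assoc, Matrix.mul_assoc, hBXY, Matrix.mul_one]
    | succ k ih =>
      rw [hrun.stepV, hT, conjTranspose_mul, conjTranspose_leftProj_mul hB hX hY hβ, ih]
      have h1 : diagonal (fun j => rho α β (ev j) ^ (k + 1)) =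
          diagonal (fun j => rho α β (ev j) ^ k) * diagonal (fun j => rho α β (ev j)) := by
        rw [diagonal_mul_diagonal]
        simp only [pow_succ]
      rw [h1]
      calc _ = (Z (k + 1))ᴴ * T k * (V₀ᴴ * B * X * diagonal (fun j => rho α β (ev j) ^ k)) *
            (Yᴴ * B * X) * diagonal (fun j => rho α β (ev j)) * Yᴴ := by
            simp only [Matrix.mul_assoc]
        _ = _ := by
            rw [hY, Matrix.mul_one]
            simp only [Matrix.mul_assoc]

/-- Stated for a general `N` so that `N = A` with `D = diag(ev)` and `N = B` with `D = 1` are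
handled together. -/
lemma reduced_eq (hB : IsUnit B.det) (hX : A * X = B * X * diagonal ev)
    (hY : Yᴴ * B * X = 1) (hβ : ∀ l j, β l ≠ ev j) {S T : Matrix (Fin p) (Fin p) ℂ}
    {U V : Matrix (Fin n) (Fin p) ℂ} {k : ℕ}
    (hU : U = X * (diagonal (fun j => rho α β (ev j) ^ k) * (Yᴴ * B * U₀) * S))
    (hV : Vᴴ = T * (V₀ᴴ * B * X * diagonal (fun j => rho α β (ev j) ^ k)) * Yᴴ)
    {N D : Matrix (Fin n) (Fin n) ℂ} (hN : Yᴴ * N * X = D) :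
    reduced α β A B N U V =
      T * (V₀ᴴ * B * X * diagonal (fun j => rho α β (ev j) ^ (k + 1)) * D *
        (diagonal (fun j => rho α β (ev j) ^ (k + 1)) * (Yᴴ * B * U₀))) * S := by
  have h1 : diagonal (fun j => rho α β (ev j) ^ (k + 1)) =
      diagonal (fun j => rho α β (ev j) ^ k) * diagonal (fun j => rho α β (ev j)) := by
    rw [diagonal_mul_diagonal]
    simp only [pow_succ]
  have h2 : diagonal (fun j => rho α β (ev j) ^ (k + 1)) =
      diagonal (fun j => rho α β (ev j)) * diagonal (fun j => rho α β (ev j) ^ k) := by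
    rw [diagonal_mul_diagonal]
    simp only [pow_succ']
  rw [reduced, conjTranspose_leftProj_mul hB hX hY hβ, rightProj_eq hB hX hY hβ, hU, hV]
  conv_rhs => rw [← hN]
  calc _ = T * (V₀ᴴ * B * X * diagonal (fun j => rho α β (ev j) ^ k)) * (Yᴴ * B * X) *
        diagonal (fun j => rho α β (ev j)) * (Yᴴ * N * X) * diagonal (fun j => rho α β (ev j)) *
        (Yᴴ * B * X) * (diagonal (fun j => rho α β (ev j) ^ k) * (Yᴴ * B * U₀) * S) := by
        simp only [Matrix.mul_assoc]
    _ = T * (V₀ᴴ * B * X * (diagonal (fun j => rho α β (ev j) ^ k) *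
        diagonal (fun j => rho α β (ev j))) * (Yᴴ * N * X) *
        (diagonal (fun j => rho α β (ev j)) * diagonal (fun j => rho α β (ev j) ^ k) *
          (Yᴴ * B * U₀))) * S := by
        rw [hY]
        simp only [Matrix.mul_assoc, Matrix.one_mul]
    _ = _ := by rw [← h1, ← h2]

/-- Residual of a vector given in right eigenvector coordinates. -/
lemma enorm2_right_residual_le (hX : A * X = B * X * diagonal ev) (hY : Yᴴ * B * X = 1)
    {z : ℂ} {w : Fin n → ℂ} {C : ℝ} (hC : 0 ≤ C)
    (h : l2norm (fun i => (ev i - z) * w i) ≤ C * l2norm w) :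
    enorm2 ((A - z • B) *ᵥ (X *ᵥ w)) ≤ ‖B * X‖ * ‖Yᴴ * B‖ * C * enorm2 (X *ᵥ w) := by
  have h1 : (A - z • B) *ᵥ (X *ᵥ w) = (B * X) *ᵥ fun i => (ev i - z) * w i := by
    have h2 : (fun i => (ev i - z) * w i) = (diagonal ev - z • 1) *ᵥ w := by
      ext i
      simp [sub_mulVec, mulVec_diagonal, sub_mul, smul_mulVec]
    rw [h2, mulVec_mulVec, mulVec_mulVec, Matrix.sub_mul, hX, Matrix.mul_sub, Matrix.smul_mul,
      Matrix.mul_smul, Matrix.mul_one]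
  have h3 : l2norm w ≤ ‖Yᴴ * B‖ * enorm2 (X *ᵥ w) := by
    have h4 : w = (Yᴴ * B) *ᵥ (X *ᵥ w) := by rw [mulVec_mulVec, hY, one_mulVec]
    conv_lhs => rw [h4]
    exact l2norm_mulVec_le _ _
  rw [h1]
  calc _ ≤ ‖B * X‖ * l2norm (fun i => (ev i - z) * w i) := l2norm_mulVec_le _ _
    _ ≤ ‖B * X‖ * (C * (‖Yᴴ * B‖ * enorm2 (X *ᵥ w))) := by
        gcongr
        exact h.trans (mul_le_mul_of_nonneg_left h3 hC)
    _ = _ := by ring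

/-- Residual of a vector given in left eigenvector coordinates. -/
lemma enorm2_left_residual_le (hX : A * X = B * X * diagonal ev) (hY : Yᴴ * B * X = 1)
    {z : ℂ} {w : Fin n → ℂ} {C : ℝ} (hC : 0 ≤ C)
    (h : l2norm (fun i => (ev i - z) * w i) ≤ C * l2norm w) :
    enorm2 ((A - z • B)ᴴ *ᵥ (Y *ᵥ star w)) ≤
      ‖B * X‖ * ‖Yᴴ * B‖ * C * enorm2 (Y *ᵥ star w) := by
  have hXY : X * (Yᴴ * B) = 1 := mul_eq_one_comm.mp hY
  have hYA : Yᴴ * (A - z • B) = (diagonal ev - z • 1) * (Yᴴ * B) := by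
    calc Yᴴ * (A - z • B) = Yᴴ * (A - z • B) * (X * (Yᴴ * B)) := by rw [hXY, Matrix.mul_one]
      _ = Yᴴ * (A * X - z • (B * X)) * (Yᴴ * B) := by
          rw [Matrix.mul_assoc, ← Matrix.mul_assoc _ X, Matrix.sub_mul, Matrix.smul_mul,
            ← Matrix.mul_assoc Yᴴ]
      _ = (Yᴴ * B * X * diagonal ev - z • (Yᴴ * B * X)) * (Yᴴ * B) := by
          rw [hX, Matrix.mul_sub, Matrix.mul_smul]
          simp only [Matrix.mul_assoc]
      _ = _ := by rw [hY, Matrix.one_mul]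
  have h1 : (A - z • B)ᴴ *ᵥ (Y *ᵥ star w) = (Yᴴ * B)ᴴ *ᵥ star (fun i => (ev i - z) * w i) := by
    have h2 : (fun i => (ev i - z) * w i) = w ᵥ* (diagonal ev - z • 1) := by
      ext i
      simp [vecMul_sub, vecMul_diagonal, mul_sub, vecMul_smul, mul_comm]
    have h3 : (A - z • B)ᴴ * Y = (Yᴴ * (A - z • B))ᴴ := by
      rw [conjTranspose_mul, conjTranspose_conjTranspose]
    rw [mulVec_mulVec, h3, hYA, h2, star_vecMul, mulVec_mulVec, conjTranspose_mul]
  have h3 : l2norm w ≤ ‖B * X‖ * enorm2 (Y *ᵥ star w) := by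
    have h4 : star w = (B * X)ᴴ *ᵥ (Y *ᵥ star w) := by
      have h5 : (B * X)ᴴ * Y = (Yᴴ * B * X)ᴴ := by
        rw [Matrix.mul_assoc Yᴴ, conjTranspose_mul Yᴴ, conjTranspose_conjTranspose]
      rw [mulVec_mulVec, h5, hY, conjTranspose_one, one_mulVec]
    rw [← l2norm_star w]
    conv_lhs => rw [h4]
    rw [← l2_opNorm_conjTranspose (B * X)]
    exact l2norm_mulVec_le _ _
  rw [h1]
  calc _ ≤ ‖(Yᴴ * B)ᴴ‖ * l2norm (star fun i => (ev i - z) * w i) := l2norm_mulVec_le _ _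
    _ ≤ ‖Yᴴ * B‖ * (C * (‖B * X‖ * enorm2 (Y *ᵥ star w))) := by
        rw [l2_opNorm_conjTranspose, l2norm_star]
        gcongr
        exact h.trans (mul_le_mul_of_nonneg_left h3 hC)
    _ = _ := by ring

end Run

/-! ### Couplings between wanted and unwanted coordinates -/

section Coupling

variable {n p : ℕ} {ι c : Type*} [Fintype ι] [Fintype c] [DecidableEq ι] [DecidableEq c]

/-- `diag(γ₁)⁻ᵏ F diag(γ₂)ᵏ`. -/
noncomputable def leftCoupling (γ₁ : ι → ℂ) (γ₂ : c → ℂ) (F : Matrix ι c ℂ) (k : ℕ) :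
    Matrix ι c ℂ :=
  diagonal (fun i => (γ₁ i)⁻¹ ^ k) * F * diagonal (fun j => γ₂ j ^ k)

/-- `diag(γ₂)ᵏ E diag(γ₁)⁻ᵏ`. -/
noncomputable def rightCoupling (γ₁ : ι → ℂ) (γ₂ : c → ℂ) (E : Matrix c ι ℂ) (k : ℕ) :
    Matrix c ι ℂ :=
  diagonal (fun j => γ₂ j ^ k) * E * diagonal (fun i => (γ₁ i)⁻¹ ^ k)

lemma diagonal_inv_pow_mul_diagonal_pow {γ : ι → ℂ} (h : ∀ i, γ i ≠ 0) (k : ℕ) :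
    diagonal (fun i => (γ i)⁻¹ ^ k) * diagonal (fun i => γ i ^ k) = 1 := by
  rw [diagonal_mul_diagonal]
  have h1 : ∀ i, (γ i)⁻¹ ^ k * γ i ^ k = 1 := fun i => by
    rw [← mul_pow, inv_mul_cancel₀ (h i), one_pow]
  simp only [h1, diagonal_one]

lemma diagonal_pow_mul_diagonal_inv_pow {γ : ι → ℂ} (h : ∀ i, γ i ≠ 0) (k : ℕ) :
    diagonal (fun i => γ i ^ k) * diagonal (fun i => (γ i)⁻¹ ^ k) = 1 :=
  mul_eq_one_comm.mp (diagonal_inv_pow_mul_diagonal_pow h k)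

/-- The leading rows, invertible by `hu` and `hγ`, are factored out on the right. What remains below
the identity is `Γ₂ᵏ (u₂ u₁⁻¹) Γ₁⁻ᵏ`. -/
lemma submatrix_diagonal_pow_mul {γ : Fin n → ℂ} (e : ι ⊕ c ≃ Fin n) (e₁ : ι ≃ Fin p)
    (u : Matrix (Fin n) (Fin p) ℂ) (hu : IsUnit (u.submatrix (e ∘ Sum.inl) e₁).det)
    (hγ : ∀ i, γ (e (Sum.inl i)) ≠ 0) (k : ℕ) :
    (diagonal (fun j => γ j ^ k) * u).submatrix e e₁ =
      fromRows (1 : Matrix ι ι ℂ) (rightCoupling (γ ∘ e ∘ Sum.inl) (γ ∘ e ∘ Sum.inr)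
        (u.submatrix (e ∘ Sum.inr) e₁ * (u.submatrix (e ∘ Sum.inl) e₁)⁻¹) k) *
      (diagonal (fun i => γ (e (Sum.inl i)) ^ k) * u.submatrix (e ∘ Sum.inl) e₁) := by
  have h : (diagonal (fun j => γ j ^ k) * u).submatrix e e₁ =
      fromRows (diagonal (fun i => γ (e (Sum.inl i)) ^ k) * u.submatrix (e ∘ Sum.inl) e₁)
        (diagonal (fun i => γ (e (Sum.inr i)) ^ k) * u.submatrix (e ∘ Sum.inr) e₁) := by
    ext (i | i) j <;> simp
  rw [h, fromRows_mul, Matrix.one_mul]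
  congr 1
  set u₁ := u.submatrix (e ∘ Sum.inl) e₁
  set u₂ := u.submatrix (e ∘ Sum.inr) e₁
  have h1 := diagonal_inv_pow_mul_diagonal_pow hγ k
  calc _ = diagonal (fun i => γ (e (Sum.inr i)) ^ k) * (u₂ * (u₁⁻¹ *
        (diagonal (fun i => (γ (e (Sum.inl i)))⁻¹ ^ k) *
          diagonal (fun i => γ (e (Sum.inl i)) ^ k) * u₁))) := by
        rw [h1, Matrix.one_mul, nonsing_inv_mul _ hu, Matrix.mul_one]
    _ = _ := by
        simp only [rightCoupling, Matrix.mul_assoc, Function.comp_def]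

lemma submatrix_mul_diagonal_pow {γ : Fin n → ℂ} (e : ι ⊕ c ≃ Fin n) (e₁ : ι ≃ Fin p)
    (v : Matrix (Fin p) (Fin n) ℂ) (hv : IsUnit (v.submatrix e₁ (e ∘ Sum.inl)).det)
    (hγ : ∀ i, γ (e (Sum.inl i)) ≠ 0) (k : ℕ) :
    (v * diagonal (fun j => γ j ^ k)).submatrix e₁ e =
      (v.submatrix e₁ (e ∘ Sum.inl) * diagonal (fun i => γ (e (Sum.inl i)) ^ k)) *
      fromCols (1 : Matrix ι ι ℂ) (leftCoupling (γ ∘ e ∘ Sum.inl) (γ ∘ e ∘ Sum.inr)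
        ((v.submatrix e₁ (e ∘ Sum.inl))⁻¹ * v.submatrix e₁ (e ∘ Sum.inr)) k) := by
  have h : (v * diagonal (fun j => γ j ^ k)).submatrix e₁ e =
      fromCols (v.submatrix e₁ (e ∘ Sum.inl) * diagonal (fun i => γ (e (Sum.inl i)) ^ k))
        (v.submatrix e₁ (e ∘ Sum.inr) * diagonal (fun i => γ (e (Sum.inr i)) ^ k)) := by
    ext i (j | j) <;> simp
  rw [h, mul_fromCols, Matrix.mul_one]
  congr 1
  set v₁ := v.submatrix e₁ (e ∘ Sum.inl)
  set v₂ := v.submatrix e₁ (e ∘ Sum.inr)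
  have h1 := diagonal_pow_mul_diagonal_inv_pow hγ k
  calc _ = v₁ * (diagonal (fun i => γ (e (Sum.inl i)) ^ k) *
          diagonal (fun i => (γ (e (Sum.inl i)))⁻¹ ^ k)) * v₁⁻¹ * v₂ *
          diagonal (fun i => γ (e (Sum.inr i)) ^ k) := by
        rw [h1, Matrix.mul_one, mul_nonsing_inv _ hv, Matrix.one_mul]
    _ = _ := by
        simp only [leftCoupling, Matrix.mul_assoc, Function.comp_def]

lemma norm_diagonal_pow_le {γ : ι → ℂ} {g : ℝ} (hg : 0 ≤ g) (h : ∀ i, ‖γ i‖ ≤ g) (k : ℕ) :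
    ‖diagonal (fun i => γ i ^ k)‖ ≤ g ^ k := by
  rw [l2_opNorm_diagonal, pi_norm_le_iff_of_nonneg (by positivity)]
  intro i
  rw [norm_pow]
  gcongr
  exact h i

lemma norm_diagonal_inv_pow_le {γ : ι → ℂ} {g : ℝ} (hg : 0 < g) (h : ∀ i, g ≤ ‖γ i‖) (k : ℕ) :
    ‖diagonal (fun i => (γ i)⁻¹ ^ k)‖ ≤ g⁻¹ ^ k :=
  norm_diagonal_pow_le (by positivity) (fun i => by
    rw [norm_inv]
    gcongr
    exact h i) k

lemma norm_leftCoupling_le {γ₁ : ι → ℂ} {γ₂ : c → ℂ} {g₁ g₂ D : ℝ} (hg₁ : 0 < g₁) (hg₂ : 0 ≤ g₂)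
    (h₁ : ∀ i, g₁ ≤ ‖γ₁ i‖) (h₂ : ∀ j, ‖γ₂ j‖ ≤ g₂) {F : Matrix ι c ℂ} (hF : ‖F‖ ≤ D) (k : ℕ) :
    ‖leftCoupling γ₁ γ₂ F k‖ ≤ D * (g₂ / g₁) ^ k := by
  refine (norm_mul_mul_le (norm_diagonal_inv_pow_le hg₁ h₁ k) hF
    (norm_diagonal_pow_le hg₂ h₂ k)).trans (le_of_eq ?_)
  rw [div_eq_mul_inv, mul_pow]
  ring

lemma norm_rightCoupling_le {γ₁ : ι → ℂ} {γ₂ : c → ℂ} {g₁ g₂ D : ℝ} (hg₁ : 0 < g₁) (hg₂ : 0 ≤ g₂)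
    (h₁ : ∀ i, g₁ ≤ ‖γ₁ i‖) (h₂ : ∀ j, ‖γ₂ j‖ ≤ g₂) {E : Matrix c ι ℂ} (hE : ‖E‖ ≤ D) (k : ℕ) :
    ‖rightCoupling γ₁ γ₂ E k‖ ≤ D * (g₂ / g₁) ^ k := by
  refine (norm_mul_mul_le (norm_diagonal_pow_le hg₂ h₂ k) hE
    (norm_diagonal_inv_pow_le hg₁ h₁ k)).trans (le_of_eq ?_)
  rw [div_eq_mul_inv, mul_pow]
  ring

lemma exists_gradedBound {a b : Type*} [Fintype a] [Fintype b] [DecidableEq a] [DecidableEq b]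
    {γ : a ⊕ b → ℂ} {γ₃ : c → ℂ} {g₁ g₂ g₃ : ℝ} (hg₁ : 0 < g₁) (hg₂ : 0 < g₂) (hg₃ : 0 ≤ g₃)
    (h₁ : ∀ i, g₁ ≤ ‖γ (Sum.inl i)‖) (h₂ : ∀ i, g₂ ≤ ‖γ (Sum.inr i)‖) (h₃ : ∀ j, ‖γ₃ j‖ ≤ g₃)
    (F : Matrix (a ⊕ b) c ℂ) (E : Matrix c (a ⊕ b) ℂ) :
    ∃ D, 0 ≤ D ∧ ∀ k, GradedBound (leftCoupling γ γ₃ F k) (rightCoupling γ γ₃ E k)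
      (D * (g₃ / g₁) ^ k) (D * (g₃ / g₂) ^ k) := by
  have hF₁ := norm_nonneg F.toRows₁
  have hF₂ := norm_nonneg F.toRows₂
  have hE₁ := norm_nonneg E.toCols₁
  have hE₂ := norm_nonneg E.toCols₂
  refine ⟨‖F.toRows₁‖ + ‖F.toRows₂‖ + ‖E.toCols₁‖ + ‖E.toCols₂‖, by positivity,
    fun k => ⟨?_, ?_, ?_, ?_⟩⟩
  · have h : (leftCoupling γ γ₃ F k).toRows₁ =
        leftCoupling (fun i => γ (Sum.inl i)) γ₃ F.toRows₁ k := by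
      ext i j
      simp [leftCoupling]
    rw [h]
    exact norm_leftCoupling_le hg₁ hg₃ h₁ h₃ (by linarith) k
  · have h : (leftCoupling γ γ₃ F k).toRows₂ =
        leftCoupling (fun i => γ (Sum.inr i)) γ₃ F.toRows₂ k := by
      ext i j
      simp [leftCoupling]
    rw [h]
    exact norm_leftCoupling_le hg₂ hg₃ h₂ h₃ (by linarith) k
  · have h : (rightCoupling γ γ₃ E k).toCols₁ =
        rightCoupling (fun i => γ (Sum.inl i)) γ₃ E.toCols₁ k := by
      ext i j
      simp [rightCoupling]
    rw [h]
    exact norm_rightCoupling_le hg₁ hg₃ h₁ h₃ (by linarith) k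
  · have h : (rightCoupling γ γ₃ E k).toCols₂ =
        rightCoupling (fun i => γ (Sum.inr i)) γ₃ E.toCols₂ k := by
      ext i j
      simp [rightCoupling]
    rw [h]
    exact norm_rightCoupling_le hg₂ hg₃ h₂ h₃ (by linarith) k

/-- The reduced matrices in terms of the couplings. -/
lemma fromCols_mul_diagonal_mul_fromRows (L : Matrix ι c ℂ) (M : Matrix c ι ℂ) (Λ : ι → ℂ)
    (l₃ : c → ℂ) :
    fromCols (1 : Matrix ι ι ℂ) L * diagonal (Sum.elim Λ l₃) * fromRows (1 : Matrix ι ι ℂ) M =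
      diagonal Λ + L * diagonal l₃ * M := by
  have h : diagonal (Sum.elim Λ l₃) = fromBlocks (diagonal Λ) 0 0 (diagonal l₃) :=
    (fromBlocks_diagonal Λ l₃).symm
  rw [h, fromCols_mul_fromBlocks, fromCols_mul_fromRows]
  simp

/-- Taking determinants in the bi-orthogonality relation shows that every factor is invertible. This
is also the source of the invertibility of `1 + L M` in the application. Cancelling `T` or `S` then
leaves eigenvector equations for `(a, b)`. -/
lemma eigenvectors_of_solve {a b S T W Z : Matrix ι ι ℂ} {r : ι → ℂ}
    (hS : IsUnit S.det) (hT : IsUnit T.det)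
    (hsolve : T * a * S = T * b * S * W * diagonal r * Z * (T * b * S))
    (hbi : Z * (T * b * S) * W = 1) :
    IsUnit b.det ∧ IsUnit (S * W).det ∧ a * (S * W) = b * (S * W) * diagonal r ∧
      Z * T * a = diagonal r * (Z * T) * b := by
  have hS' := (isUnit_iff_isUnit_det S).mpr hS
  have hT' := (isUnit_iff_isUnit_det T).mpr hT
  have hdet : IsUnit (Z.det * (T.det * b.det * S.det) * W.det) := by
    rw [← det_mul, ← det_mul, ← det_mul, ← det_mul, hbi, det_one]
    exact isUnit_one
  simp only [IsUnit.mul_iff] at hdet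
  refine ⟨hdet.1.2.1.2, by rw [det_mul]; exact hS.mul hdet.2, ?_, ?_⟩
  · refine hT'.mul_left_cancel ?_
    calc T * (a * (S * W)) = T * a * S * W := by simp only [Matrix.mul_assoc]
      _ = T * b * S * W * diagonal r * (Z * (T * b * S) * W) := by
          rw [hsolve]
          simp only [Matrix.mul_assoc]
      _ = _ := by
          rw [hbi, Matrix.mul_one]
          simp only [Matrix.mul_assoc]
  · refine hS'.mul_right_cancel ?_
    calc Z * T * a * S = Z * (T * a * S) := by simp only [Matrix.mul_assoc]
      _ = Z * (T * b * S) * W * diagonal r * (Z * (T * b * S)) := by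
          rw [hsolve]
          simp only [Matrix.mul_assoc]
      _ = _ := by
          rw [hbi, Matrix.one_mul]
          simp only [Matrix.mul_assoc]

/-- `B̂⁻¹ Â` is similar to `b⁻¹ a` if `Â = T a S` and `B̂ = T b S`. -/
lemma exists_similarity {rA rB : Matrix (Fin p) (Fin p) ℂ} (e₁ : ι ≃ Fin p)
    {a b S T : Matrix ι ι ℂ} (hS : IsUnit S.det) (hT : IsUnit T.det)
    (hA : rA.submatrix e₁ e₁ = T * a * S) (hB : rB.submatrix e₁ e₁ = T * b * S) :
    ∃ (P : Matrix (Fin p) ι ℂ) (Q : Matrix ι (Fin p) ℂ),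
      P * Q = 1 ∧ Q * P = 1 ∧ b⁻¹ * a = Q * (rB⁻¹ * rA) * P := by
  have hid : ∀ N : Matrix ι ι ℂ, N.submatrix id id = N := fun N => rfl
  have hrA : rA = (T * a * S).submatrix e₁.symm e₁.symm := by rw [← hA]; simp
  have hrB : rB = (T * b * S).submatrix e₁.symm e₁.symm := by rw [← hB]; simp
  refine ⟨S⁻¹.submatrix e₁.symm id, S.submatrix id e₁.symm, ?_, ?_, ?_⟩
  · have h := submatrix_mul_equiv S⁻¹ S e₁.symm (Equiv.refl ι) e₁.symm
    rw [nonsing_inv_mul _ hS, submatrix_one_equiv] at h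
    exact h
  · rw [submatrix_mul_equiv, mul_nonsing_inv _ hS, hid]
  · rw [hrA, hrB, inv_submatrix_equiv, submatrix_mul_equiv, submatrix_mul_equiv,
      submatrix_mul_equiv, hid, Matrix.mul_inv_rev, Matrix.mul_inv_rev]
    calc b⁻¹ * a = (S * S⁻¹) * b⁻¹ * (T⁻¹ * T) * a * (S * S⁻¹) := by
          rw [mul_nonsing_inv _ hS, nonsing_inv_mul _ hT]
          simp
      _ = _ := by simp only [Matrix.mul_assoc]

lemma submatrix_mul_diagonal_mul (e : ι ⊕ c ≃ Fin n) (e₁ : ι ≃ Fin p)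
    {R : Matrix (Fin p) (Fin n) ℂ} {Q : Matrix (Fin n) (Fin p) ℂ} {PL PR : Matrix ι ι ℂ}
    {L : Matrix ι c ℂ} {M : Matrix c ι ℂ}
    (hR : R.submatrix e₁ e = PL * fromCols (1 : Matrix ι ι ℂ) L)
    (hQ : Q.submatrix e e₁ = fromRows (1 : Matrix ι ι ℂ) M * PR) (d : Fin n → ℂ)
    (T S : Matrix (Fin p) (Fin p) ℂ) :
    (T * (R * diagonal d * Q) * S).submatrix e₁ e₁ =
      T.submatrix e₁ e₁ * PL *
        (diagonal (d ∘ e ∘ Sum.inl) + L * diagonal (d ∘ e ∘ Sum.inr) * M) *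
        (PR * S.submatrix e₁ e₁) := by
  have hd : (diagonal d).submatrix e e =
      diagonal (Sum.elim (d ∘ e ∘ Sum.inl) (d ∘ e ∘ Sum.inr)) := by
    rw [submatrix_diagonal_equiv]
    congr 1
    ext (x | x) <;> rfl
  rw [← submatrix_mul_equiv _ _ _ e₁, ← submatrix_mul_equiv _ _ _ e₁,
    ← submatrix_mul_equiv _ _ _ e, ← submatrix_mul_equiv _ _ _ e, hR, hQ, hd,
    ← fromCols_mul_diagonal_mul_fromRows]
  simp only [Matrix.mul_assoc]

end Coupling

/-! ### Ritz vectors in block coordinates -/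

section Coordinates

variable {n p : ℕ} {ι c : Type*}

lemma comp_col_eq_sumElim [Fintype ι] [DecidableEq ι] (e : ι ⊕ c ≃ Fin n)
    (e₁ : ι ≃ Fin p) {Q : Matrix (Fin n) (Fin p) ℂ}
    {M : Matrix c ι ℂ} {G : Matrix ι ι ℂ}
    (hQ : Q.submatrix e e₁ = fromRows (1 : Matrix ι ι ℂ) M * G) (x : ι) :
    Q.col (e₁ x) ∘ e = Sum.elim (G.col x) (M *ᵥ G.col x) := by
  rw [fromRows_mul, Matrix.one_mul] at hQ
  ext (i | i)
  · exact congrFun (congrFun hQ (Sum.inl i)) x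
  · exact congrFun (congrFun hQ (Sum.inr i)) x

lemma comp_row_eq_sumElim [Fintype ι] [DecidableEq ι] (e : ι ⊕ c ≃ Fin n)
    (e₁ : ι ≃ Fin p) {R : Matrix (Fin p) (Fin n) ℂ}
    {L : Matrix ι c ℂ} {H : Matrix ι ι ℂ}
    (hR : R.submatrix e₁ e = H * fromCols (1 : Matrix ι ι ℂ) L) (x : ι) :
    R.row (e₁ x) ∘ e = Sum.elim (H.row x) (Lᵀ *ᵥ H.row x) := by
  rw [mul_fromCols, Matrix.mul_one] at hR
  ext (i | i)
  · exact congrFun (congrFun hR x) (Sum.inl i)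
  · rw [mulVec_transpose]
    exact congrFun (congrFun hR x) (Sum.inr i)

lemma l2norm_residual_of_comp_equiv [Fintype ι] [Fintype c] (e : ι ⊕ c ≃ Fin n)
    {ev w : Fin n → ℂ} {f : ι ⊕ c → ℂ} (hw : w ∘ e = f) {z : ℂ} {C : ℝ}
    (h : l2norm (fun x => (Sum.elim (ev ∘ e ∘ Sum.inl) (ev ∘ e ∘ Sum.inr) x - z) * f x)
      ≤ C * l2norm f) :
    l2norm (fun i => (ev i - z) * w i) ≤ C * l2norm w := by
  rw [← l2norm_comp_equiv e w, ← l2norm_comp_equiv e, hw]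
  convert h using 2
  ext (x | x) <;> simp [← hw]

end Coordinates

end BiFEAST

/-! ### Assembly -/

theorem mainTheorem4 {n p m' q : ℕ}
    (A B X Y : Matrix (Fin n) (Fin n) ℂ) (ev : Fin n → ℂ)
    (hB : IsUnit B.det)
    -- eigendecomposition with bi-orthogonal right and left eigenvectors
    (hX : A * X = B * X * Matrix.diagonal ev)
    (hY : Y.conjTranspose * B * X = 1)
    -- the rational function; no pole is an eigenvalue
    (α β : Fin q → ℂ) (hβ : ∀ l j, β l ≠ ev j)
    -- numbering with `|γ₁| ≥ ... ≥ |γₙ|`, where `γⱼ = ρ(λⱼ)`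
    (hγ : ∀ i j : Fin n, i ≤ j → ‖BiFEAST.rho α β (ev j)‖ ≤ ‖BiFEAST.rho α β (ev i)‖)
    (hm : 0 < m') (hmp : m' ≤ p) (hpn : p < n)
    -- `|γⱼ| < |γᵢ|` for `i ≤ m' < j`, and for `i ≤ p < j`
    (hgap_m : ∀ i j : Fin n, (i : ℕ) < m' → m' ≤ (j : ℕ) →
      ‖BiFEAST.rho α β (ev j)‖ < ‖BiFEAST.rho α β (ev i)‖)
    (hgap_p : ∀ i j : Fin n, (i : ℕ) < p → p ≤ (j : ℕ) →
      ‖BiFEAST.rho α β (ev j)‖ < ‖BiFEAST.rho α β (ev i)‖)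
    -- the starting matrices
    (U₀ V₀ : Matrix (Fin n) (Fin p) ℂ)
    (hUV : V₀.conjTranspose * B * U₀ = 1)
    (hU₀ : IsUnit ((BiFEAST.firstCols hpn.le Y).conjTranspose * B * U₀).det)
    (hV₀ : IsUnit (V₀.conjTranspose * B * BiFEAST.firstCols hpn.le X).det)
    -- `ε = |γ_{p+1} / γ_{m'}|`
    (ε : ℝ)
    (hε : ε = ‖BiFEAST.rho α β (ev ⟨p, hpn⟩) /
      BiFEAST.rho α β (ev ⟨m' - 1, by omega⟩)‖) :
    ∃ C : ℝ, ∀ (U V : ℕ → Matrix (Fin n) (Fin p) ℂ) (W Z : ℕ → Matrix (Fin p) (Fin p) ℂ)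
      (ritz : ℕ → Fin p → ℂ), BiFEAST.IsRun α β A B U₀ V₀ U V W Z ritz →
      ∀ k : ℕ, 1 ≤ k →
        -- `B̂⁻¹Â` of step `k` is similar to a matrix of the asserted block form
        (∃ (A₁₁ : Matrix (Fin m') (Fin m') ℂ) (A₁₂ : Matrix (Fin m') (Fin (p - m')) ℂ)
            (A₂₁ : Matrix (Fin (p - m')) (Fin m') ℂ)
            (A₂₂ : Matrix (Fin (p - m')) (Fin (p - m')) ℂ)
            (P : Matrix (Fin p) (Fin m' ⊕ Fin (p - m')) ℂ)
            (Q : Matrix (Fin m' ⊕ Fin (p - m')) (Fin p) ℂ),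
          P * Q = 1 ∧ Q * P = 1 ∧
          Matrix.fromBlocks A₁₁ A₁₂ A₂₁ A₂₂ =
            Q * ((BiFEAST.reduced α β A B B (U (k - 1)) (V (k - 1)))⁻¹ *
              BiFEAST.reduced α β A B A (U (k - 1)) (V (k - 1))) * P ∧
          ‖A₁₁ - Matrix.diagonal (fun j : Fin m' => ev (Fin.castLE (hmp.trans hpn.le) j))‖
            ≤ C * ε ^ (2 * k) ∧
          ‖A₂₁‖ ≤ C * ε ^ k ∧ ‖A₁₂‖ ≤ C * ε ^ k) ∧
        -- `m'` of the computed eigenvalues, with their columns of `U k` and `V k`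
        (∃ s : Fin m' → Fin p, Function.Injective s ∧ ∀ j : Fin m',
          ‖ritz k (s j) - ev (Fin.castLE (hmp.trans hpn.le) j)‖ ≤ C * ε ^ (2 * k) ∧
          BiFEAST.enorm2 ((A - ritz k (s j) • B).mulVec ((U k).col (s j)))
            ≤ C * ε ^ k * BiFEAST.enorm2 ((U k).col (s j)) ∧
          BiFEAST.enorm2 ((A - ritz k (s j) • B).conjTranspose.mulVec ((V k).col (s j)))
            ≤ C * ε ^ k * BiFEAST.enorm2 ((V k).col (s j))) := by
  classical
  set γ : Fin n → ℂ := fun j => BiFEAST.rho α β (ev j)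
  -- The reindexings `e₁` and `e` keep the order: the `m'` wanted indices, then those up to `p`,
  -- then the rest.
  obtain ⟨e₁, he₁l, he₁r⟩ : ∃ e₁ : Fin m' ⊕ Fin (p - m') ≃ Fin p,
      (∀ i, e₁ (Sum.inl i) = Fin.castLE hmp i) ∧ ∀ i, m' ≤ (e₁ (Sum.inr i) : ℕ) :=
    ⟨finSumFinEquiv.trans (finCongr (by omega)), fun i => by ext; simp, fun i => by simp⟩
  obtain ⟨e, hel, her⟩ : ∃ e : (Fin m' ⊕ Fin (p - m')) ⊕ Fin (n - p) ≃ Fin n,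
      (∀ i, e (Sum.inl i) = Fin.castLE hpn.le (e₁ i)) ∧ ∀ i, p ≤ (e (Sum.inr i) : ℕ) :=
    ⟨(Equiv.sumCongr e₁ (Equiv.refl _)).trans (finSumFinEquiv.trans (finCongr (by omega))),
      fun i => by ext; simp, fun i => by simp⟩
  have hel1 : ∀ i, (e (Sum.inl (Sum.inl i)) : ℕ) = i := fun i => by simp [hel, he₁l]
  have hel2 : ∀ i, m' ≤ (e (Sum.inl (Sum.inr i)) : ℕ) := fun i => by
    simpa [hel] using he₁r i
  have help : ∀ i, (e (Sum.inl i) : ℕ) < p := fun i => by simp [hel]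
  have hinl : e ∘ Sum.inl = Fin.castLE hpn.le ∘ e₁ := funext hel
  set u := Y.conjTranspose * B * U₀
  set v := V₀.conjTranspose * B * X
  have hu₁ : IsUnit (u.submatrix (e ∘ Sum.inl) e₁).det := by
    have h : u.submatrix (e ∘ Sum.inl) e₁ =
        ((BiFEAST.firstCols hpn.le Y).conjTranspose * B * U₀).submatrix e₁ e₁ := by
      rw [hinl]
      rfl
    rw [h, Matrix.det_submatrix_equiv_self]
    exact hU₀
  have hv₁ : IsUnit (v.submatrix e₁ (e ∘ Sum.inl)).det := by
    have h : v.submatrix e₁ (e ∘ Sum.inl) =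
        (V₀.conjTranspose * B * BiFEAST.firstCols hpn.le X).submatrix e₁ e₁ := by
      rw [hinl]
      rfl
    rw [h, Matrix.det_submatrix_equiv_self]
    exact hV₀
  -- With indices starting at `0`, these are `|γ_{m'}|`, `|γ_p|` and `|γ_{p+1}|`.
  set g₁ := ‖γ ⟨m' - 1, by omega⟩‖
  set g₂ := ‖γ ⟨p - 1, by omega⟩‖
  set g₃ := ‖γ ⟨p, hpn⟩‖
  have hg₃ : 0 ≤ g₃ := norm_nonneg _
  have hg₃₂ : g₃ < g₂ := hgap_p _ _ (by simp; omega) le_rfl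
  have hg₂₁ : g₂ ≤ g₁ := hγ _ _ (by rw [Fin.mk_le_mk]; omega)
  have hg₂ : 0 < g₂ := hg₃.trans_lt hg₃₂
  have hg₁ : 0 < g₁ := hg₂.trans_le hg₂₁
  have hγp : ∀ i, γ (e (Sum.inl i)) ≠ 0 := fun i => by
    have h : g₃ < ‖γ (e (Sum.inl i))‖ := hgap_p _ _ (help i) le_rfl
    exact norm_pos_iff.mp (hg₃.trans_lt h)
  have hεeq : ε = g₃ / g₁ := by rw [hε, norm_div]
  have hε0 : 0 ≤ ε := by rw [hεeq]; positivity
  set δ := g₃ / g₂ with hδdef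
  have hεδ : ε ≤ δ := by
    rw [hεeq]
    exact div_le_div_of_nonneg_left hg₃ hg₂ hg₂₁
  have hδ1 : δ < 1 := by rwa [hδdef, div_lt_one hg₂]
  have hεzero : ε = 0 → δ = 0 := fun h => by
    rw [hεeq, div_eq_zero_iff, or_iff_left hg₁.ne'] at h
    rw [hδdef, h, zero_div]
  set F := (v.submatrix e₁ (e ∘ Sum.inl))⁻¹ * v.submatrix e₁ (e ∘ Sum.inr)
  set E := u.submatrix (e ∘ Sum.inr) e₁ * (u.submatrix (e ∘ Sum.inl) e₁)⁻¹
  set L := BiFEAST.leftCoupling (γ ∘ e ∘ Sum.inl) (γ ∘ e ∘ Sum.inr) F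
  set M := BiFEAST.rightCoupling (γ ∘ e ∘ Sum.inl) (γ ∘ e ∘ Sum.inr) E
  obtain ⟨D, hD, hLM⟩ := BiFEAST.exists_gradedBound (γ := γ ∘ e ∘ Sum.inl)
    (γ₃ := γ ∘ e ∘ Sum.inr) hg₁ hg₂ hg₃
    (fun i => hγ _ _ (by
      have := hel1 i
      rw [Fin.le_def, Function.comp_apply, this]
      simp only
      omega))
    (fun i => hγ _ _ (by
      have := help (Sum.inr i)
      rw [Fin.le_def, Function.comp_apply]
      simp only
      omega))
    (fun j => hγ _ _ (by rw [Fin.le_def]; exact her j)) F E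
  rw [← hεeq] at hLM
  set Λ := ev ∘ e ∘ Sum.inl
  set l₃ := ev ∘ e ∘ Sum.inr
  -- Equal eigenvalues would have equal `γ`, contrary to the gap at `m'`.
  have hsep : ∀ i j, Λ (Sum.inl i) ≠ Λ (Sum.inr j) := fun i j h => by
    have h1 := hgap_m (e (Sum.inl (Sum.inl i))) (e (Sum.inl (Sum.inr j)))
      (by rw [hel1]; exact i.2) (hel2 j)
    have h2 : ev (e (Sum.inl (Sum.inl i))) = ev (e (Sum.inl (Sum.inr j))) := h
    rw [h2] at h1
    exact lt_irrefl _ h1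
  obtain ⟨C₁, hC₁, hpart1⟩ :=
    BiFEAST.exists_pencilMatrix_bound Λ l₃ hLM hD hε0 hεδ hδ1
  obtain ⟨C₂, hC₂, hpart2⟩ :=
    BiFEAST.exists_eigenpair_bound Λ l₃ hsep hLM hD hε0 hεδ hδ1 hεzero
  -- `N` is the price of passing between residuals in eigenvector coordinates and residuals of the
  -- original vectors.
  set N := ‖B * X‖ * ‖Y.conjTranspose * B‖
  have hN0 : 0 ≤ N := by positivity
  have hC₁le : C₁ ≤ C₁ + C₂ + N * C₂ := by
    have := mul_nonneg hN0 hC₂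
    linarith
  have hC₂le : C₂ ≤ C₁ + C₂ + N * C₂ := by
    have := mul_nonneg hN0 hC₂
    linarith
  have hevl : ∀ j, Λ (Sum.inl j) = ev (Fin.castLE (hmp.trans hpn.le) j) := fun j =>
    congrArg ev (Fin.ext (hel1 j))
  refine ⟨C₁ + C₂ + N * C₂, fun U V W Z ritz hrun k hk => ?_⟩
  obtain ⟨k, rfl⟩ : ∃ k₀, k = k₀ + 1 := ⟨k - 1, by omega⟩
  -- The reduced matrices built from the iterates of index `k` contain one further application of
  -- the filter, hence the exponent `K`.
  set K := k + 1
  have hεK : 0 ≤ ε ^ K := pow_nonneg hε0 K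
  have hpow2 : ε ^ (2 * K) = (ε ^ K) ^ 2 := by rw [mul_comm, pow_mul]
  obtain ⟨S, T, hS, hT, hSW, hTZ, hUk, hVk⟩ := hrun.exists_factorization hB hX hY hβ
  have hYAX : Y.conjTranspose * A * X = Matrix.diagonal ev := by
    rw [Matrix.mul_assoc, hX, ← Matrix.mul_assoc, ← Matrix.mul_assoc, hY, Matrix.one_mul]
  have hredA := BiFEAST.reduced_eq hB hX hY hβ (hUk k) (hVk k) hYAX
  have hredB := BiFEAST.reduced_eq hB hX hY hβ (hUk k) (hVk k) hY
  have hsolve := hrun.solve k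
  have hbi := hrun.biorth k
  set rA := BiFEAST.reduced α β A B A (U k) (V k)
  set rB := BiFEAST.reduced α β A B B (U k) (V k)
  set PR := Matrix.diagonal (fun i => γ (e (Sum.inl i)) ^ K) *
    u.submatrix (e ∘ Sum.inl) e₁ with hPR
  set PL := v.submatrix e₁ (e ∘ Sum.inl) *
    Matrix.diagonal (fun i => γ (e (Sum.inl i)) ^ K) with hPL
  have hu' : (Matrix.diagonal (fun j => γ j ^ K) * u).submatrix e e₁ =
      Matrix.fromRows 1 (M K) * PR := BiFEAST.submatrix_diagonal_pow_mul e e₁ u hu₁ hγp K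
  have hv' : (v * Matrix.diagonal (fun j => γ j ^ K)).submatrix e₁ e =
      PL * Matrix.fromCols 1 (L K) := BiFEAST.submatrix_mul_diagonal_pow e e₁ v hv₁ hγp K
  have hdiag : IsUnit (Matrix.diagonal (fun i => γ (e (Sum.inl i)) ^ K)).det := by
    rw [Matrix.det_diagonal]
    exact (Finset.prod_ne_zero_iff.mpr fun i _ => pow_ne_zero K (hγp i)).isUnit
  have hPRu : IsUnit PR.det := by
    rw [hPR, Matrix.det_mul]
    exact hdiag.mul hu₁
  have hPLu : IsUnit PL.det := by
    rw [hPL, Matrix.det_mul]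
    exact hv₁.mul hdiag
  set a := Matrix.diagonal Λ + L K * Matrix.diagonal l₃ * M K
  set b := 1 + L K * M K
  set S' := PR * (S k).submatrix e₁ e₁ with hS'
  set T' := (T k).submatrix e₁ e₁ * PL with hT'
  have hS'u : IsUnit S'.det := by
    rw [hS', Matrix.det_mul, Matrix.det_submatrix_equiv_self]
    exact hPRu.mul (hS k)
  have hT'u : IsUnit T'.det := by
    rw [hT', Matrix.det_mul, Matrix.det_submatrix_equiv_self]
    exact (hT k).mul hPLu
  have hrA' : rA.submatrix e₁ e₁ = T' * a * S' := by
    rw [hredA]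
    exact BiFEAST.submatrix_mul_diagonal_mul e e₁ hv' hu' ev (T k) (S k)
  have hrB' : rB.submatrix e₁ e₁ = T' * b * S' := by
    rw [hredB, ← Matrix.diagonal_one,
      BiFEAST.submatrix_mul_diagonal_mul e e₁ hv' hu' _ (T k) (S k)]
    have h1 : Matrix.diagonal ((fun _ => (1 : ℂ)) ∘ e ∘ Sum.inl) = 1 := Matrix.diagonal_one
    have h2 : Matrix.diagonal ((fun _ => (1 : ℂ)) ∘ e ∘ Sum.inr) = 1 := Matrix.diagonal_one
    rw [h1, h2, Matrix.mul_one]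
  have hsolve' := congrArg (fun Q => Q.submatrix e₁ e₁) hsolve
  have hbi' := congrArg (fun Q => Q.submatrix e₁ e₁) hbi
  simp only [← Matrix.submatrix_mul_equiv _ _ _ e₁, Matrix.submatrix_diagonal_equiv,
    Matrix.submatrix_one_equiv, hrA', hrB'] at hsolve' hbi'
  obtain ⟨hbu, hGu, hGeq, hHeq⟩ := BiFEAST.eigenvectors_of_solve hS'u hT'u hsolve' hbi'
  refine ⟨?_, ?_⟩
  · obtain ⟨P, Q, hPQ, hQP, hsim⟩ := BiFEAST.exists_similarity e₁ hS'u hT'u hrA' hrB'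
    obtain ⟨h11, h21, h12, -⟩ := hpart1 K hbu
    refine ⟨_, _, _, _, P, Q, hPQ, hQP, (Matrix.fromBlocks_toBlocks _).trans hsim, ?_, ?_, ?_⟩
    · have hdiagΛ : (fun j : Fin m' => ev (Fin.castLE (hmp.trans hpn.le) j)) = Λ ∘ Sum.inl :=
        funext fun j => (hevl j).symm
      rw [hdiagΛ, hpow2]
      exact h11.trans (mul_le_mul_of_nonneg_right hC₁le (by positivity))
    · exact h21.trans (mul_le_mul_of_nonneg_right hC₁le hεK)
    · exact h12.trans (mul_le_mul_of_nonneg_right hC₁le hεK)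
  · obtain ⟨s, hs, hj⟩ := hpart2 K hk hbu _ _ _ hGu hGeq hHeq
    refine ⟨e₁ ∘ s, e₁.injective.comp hs, fun j => ?_⟩
    obtain ⟨h1, h2, h3⟩ := hj j
    have hCε : 0 ≤ C₂ * ε ^ K := by positivity
    have hCres : N * (C₂ * ε ^ K) ≤ (C₁ + C₂ + N * C₂) * ε ^ K := by
      rw [← mul_assoc]
      exact mul_le_mul_of_nonneg_right (by linarith) hεK
    refine ⟨?_, ?_, ?_⟩
    · rw [hpow2, ← hevl j]
      exact h1.trans (mul_le_mul_of_nonneg_right hC₂le (by positivity))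
    · have hQ : (Matrix.diagonal (fun j => γ j ^ K) * u * S K).submatrix e e₁ =
          Matrix.fromRows 1 (M K) * (S' * (W (k + 1)).submatrix e₁ e₁) := by
        rw [hSW k, ← Matrix.submatrix_mul_equiv _ _ _ e₁, hu',
          ← Matrix.submatrix_mul_equiv _ _ _ e₁]
        simp only [hS', Matrix.mul_assoc]
      have hcol : (U K).col (e₁ (s j)) =
          X.mulVec ((Matrix.diagonal (fun j => γ j ^ K) * u * S K).col (e₁ (s j))) := by
        rw [hUk K]
        rfl
      have hres := BiFEAST.l2norm_residual_of_comp_equiv e (ev := ev)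
        (BiFEAST.comp_col_eq_sumElim e e₁ hQ (s j)) h2
      have := BiFEAST.enorm2_right_residual_le hX hY hCε hres
      rw [← hcol] at this
      exact this.trans (mul_le_mul_of_nonneg_right hCres (norm_nonneg _))
    · have hR : (T K * (v * Matrix.diagonal (fun j => γ j ^ K))).submatrix e₁ e =
          ((Z (k + 1)).conjTranspose.submatrix e₁ e₁ * T') * Matrix.fromCols 1 (L K) := by
        rw [hTZ k, ← Matrix.submatrix_mul_equiv _ _ _ e₁, hv',
          ← Matrix.submatrix_mul_equiv _ _ _ e₁]
        simp only [hT', Matrix.mul_assoc]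
      -- The factorization describes `Vᴴ`, so columns of `V` are `Y` applied to conjugated
      -- coordinate rows.
      have hcol : (V K).col (e₁ (s j)) = Y.mulVec
          (star ((T K * (v * Matrix.diagonal (fun j => γ j ^ K))).row (e₁ (s j)))) := by
        rw [← Matrix.conjTranspose_conjTranspose (V K), hVk K, Matrix.conjTranspose_mul,
          Matrix.conjTranspose_conjTranspose]
        rfl
      have hres := BiFEAST.l2norm_residual_of_comp_equiv e (ev := ev)
        (BiFEAST.comp_row_eq_sumElim e e₁ hR (s j)) h3
      have := BiFEAST.enorm2_left_residual_le hX hY hCε hres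
      rw [← hcol] at this
      exact this.trans (mul_le_mul_of_nonneg_right hCres (norm_nonneg _))
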